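/- **Proposition.** Let $\mathbb{E}^2$ be the oriented Euclidean plane, identified with $\mathbb{C}$ and also with $\mathrm{span}_{\mathbb R}\{\mathbf i,\mathbf j\}\subset\mathbb{H}$ by $x+iy\mapsto x\mathbf i+y\mathbf j$. Let $f:\mathbb{Z}\to\mathbb{E}^2$ be a regular discrete curve of constant arc-length $\eta>0$, i.e. $|f_{k+1}-f_k|=\eta$ and $f_{k-1}\ne f_{k+1}$ for all $k$. Write $u_{k,k+1}=f_{k+1}-f_k$. *Curvature.* $\kappa_k$ is twice the signed curvature of the double-curvature circle $\mathfrak c_k$, the circle that touches the oriented lines along $u_{k-1,k}$ and $u_{k,k+1}$ at $f_{k-1}$ and $f_{k+1}$; equivalently $\kappa_k=\frac2\eta\tan\frac{\varphi_k}2$ with $\varphi_k\in(-\pi,\pi)$ the turning angle at $f_k$. *Elastic curves.* $f$ is *constrained elastic* if there are $\xi,\delta\in\mathbb{R}$ with $$\kappa_{k-1}+\kappa_{k+1}=\frac{\xi\kappa_k+\delta}{1+\frac{\eta^2}{4}\kappa_k^2}\qquad\text{for all }k.$$ It is *area-constrained elastic* if this holds for some $\xi$ and some $\delta\neq0$. It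 is a *discrete circle* if $\kappa$ is constant and non-zero (discrete circles are area-constrained elastic), and *elastic* if the equation holds for some $\xi$ and $\delta=0$ and $f$ is not a discrete circle. *Directrix.* A circle with centre $X$ and squared radius $\rho\in\mathbb{R}$ (possibly $\rho\le0$) is a *directrix* of $f$ if, in the light cone model $\mathbb{R}^{3,2}$, all double-curvature circles $\mathfrak c_k$ are orthogonal to one fixed vector $\mathfrak a$ which becomes a light-like vector representing this circle after adding a (possibly complex) multiple of $(0,0,0,0,1)$. *Invariant curves.* A quad $(a,b,c,d)$ with $a\ne c$, $b\ne d$ is a *Darboux butterfly* if the reflection in some line interchanges $a\leftrightarrow c$ and $b\leftrightarrow d$. Two regular constant arc-length curves $f,\tilde f$ are related by a *Bäcklund transformation* if every quad $(f_k,f_{k+1},\tilde f_{k+1},\tilde f_k)$ is a Darboux butterfly. The curve $f$ is *$n$-invariant with isometry $\psi$* if $\psi$ is an isometry of $\mathbb{E}^2$ that is orientation preserving for odd $n$ and orientation reversing for even $n$, and there are regular constant arc-length curves $f=f^{(0)},\dots,f^{(n)}=\psi\circ f$, consecutive ones related by Bäcklund transformations, such that the sequence is regular: with $v^{(i)}_k=f^{(i+1)}_k-f^{(i)}_k$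 and a quaternion $E\neq0$ such that the linear part of $\psi$ is $u\mapsto E^{-1}uE$, the quaternionic polynomial $\mathcal P_k(\lambda)=E(1+\lambda v_k^{(n-1)})\cdots(1+\lambda v_k^{(0)})$ is not scalar, i.e. some coefficient has non-zero imaginary part (for some $k$). The curve is *$n$-invariant* if it is $n$-invariant with some isometry. Then: 1. $f$ is $3$-invariant if and only if $f$ is constrained elastic. 2. If $f$ is $3$-invariant with a rotation $\psi$ (angle not a multiple of $2\pi$), then $f$ is area-constrained elastic, and there are the fixed point $X$ of $\psi$, some $\rho\in\mathbb{R}$ and some $c\neq0$ such that the circle with centre $X$ and squared radius $\rho$ is a directrix of $f$ and the squared tangential distance to it is proportional to the curvature: $|f_k-X|^2-\rho=c\,\kappa_k$ for all $k$. Conversely, every area-constrained elastic curve is $3$-invariant with some rotation. 3. If $f$ is $3$-invariant with a translation (possibly the identity), then $f$ is elastic or a discrete circle. Conversely, every elastic curve and every discrete circle is $3$-invariant with some translation. -/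

import Mathlib

open scoped Quaternion Polynomial

noncomputable section

namespace DiscreteElastica

/-! The Euclidean plane is `ℂ` with its Euclidean metric; multiplication by `Complex.I` is the
rotation by a positive right angle. A discrete curve is a map `ℤ → ℂ`. -/

/-- Regular discrete curves parametrized by constant arc-length `η`: consecutive points have
distance `η > 0` and any three consecutive points are pairwise distinct. -/
def IsArcLengthCurve (η : ℝ) (f : ℤ → ℂ) : Prop :=
  0 < η ∧ (∀ k, dist (f k) (f (k + 1)) = η) ∧ ∀ k, f (k - 1) ≠ f (k + 1)

/-- The unit normal of the oriented line from `a` to `b`. -/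
def edgeNormal (a b : ℂ) : ℂ := Complex.I * (b - a) / (‖b - a‖ : ℂ)

/-- Twice the signed curvature of the circle which touches the oriented edge `a → b` at `a` and the
oriented edge `b → c` at `c`, for `‖b - a‖ = ‖c - b‖`; see `edgeNormal_sub_edgeNormal`.
If `φ` is the turning angle at `b` and `η` the edge length, it equals `(2 / η) * tan (φ / 2)`. -/
def curvatureAt (a b c : ℂ) : ℝ :=
  4 * (starRingEnd ℂ (b - a) * (c - b)).im / (‖c - b‖ * ‖c - a‖ ^ 2)

/-- The defining property of `κ = curvatureAt a b c`: for `κ ≠ 0`, it says that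
`a + (2 / κ) N_ab = c + (2 / κ) N_bc`, so the circle of signed radius `2 / κ` about this point
touches the two oriented edges at `a` and `c`; for `κ = 0` the two edges are parallel. -/
theorem edgeNormal_sub_edgeNormal {a b c : ℂ} (hab : a ≠ b) (hac : a ≠ c)
    (h : ‖b - a‖ = ‖c - b‖) :
    edgeNormal a b - edgeNormal b c = (curvatureAt a b c / 2 : ℝ) * (c - a) := by
  obtain ⟨u, rfl⟩ : ∃ u, b = a + u := ⟨b - a, by ring⟩
  obtain ⟨v, rfl⟩ : ∃ v, c = a + u + v := ⟨c - (a + u), by ring⟩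
  have h1 : a + u - a = u := by ring
  have h2 : a + u + v - (a + u) = v := by ring
  have h3 : a + u + v - a = u + v := by ring
  unfold edgeNormal curvatureAt
  rw [h1, h2] at h
  rw [h1, h2, h3]
  have hu : u ≠ 0 := fun h0 => hab (by simp [h0])
  have huv : u + v ≠ 0 := fun h0 => hac (by rw [add_assoc, h0, add_zero])
  have hv : (‖v‖ : ℂ) ≠ 0 := by rw [← h]; exact_mod_cast norm_ne_zero_iff.2 hu
  have hn : (‖u + v‖ : ℂ) ≠ 0 := by exact_mod_cast norm_ne_zero_iff.2 huv
  have key : Complex.I * (u - v) * (starRingEnd ℂ (u + v))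
      = 2 * ((starRingEnd ℂ u * v).im : ℂ) := by
    have e : u.re ^ 2 + u.im ^ 2 = v.re ^ 2 + v.im ^ 2 := by
      have := congrArg (· ^ 2) h
      simp only [Complex.sq_norm, Complex.normSq_apply] at this
      linarith
    apply Complex.ext <;> simp <;> linarith
  have hsq : (u + v) * (starRingEnd ℂ (u + v)) = (‖u + v‖ : ℂ) ^ 2 := Complex.mul_conj' _
  have hconj : starRingEnd ℂ (u + v) ≠ 0 := (map_ne_zero _).2 huv
  apply mul_right_cancel₀ hconj
  rw [h, ← sub_div, div_mul_eq_mul_div, ← mul_sub, key, mul_assoc, hsq]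
  push_cast
  field_simp
  norm_num
  ring

/-- The curvature `κ_k` of the discrete curve `f` at the curve point `f k`. -/
def curvature (f : ℤ → ℂ) (k : ℤ) : ℝ := curvatureAt (f (k - 1)) (f k) (f (k + 1))

/-! ### Constrained elastic curves -/

/-- The curvature equation with constants `ξ` and `δ`. -/
def CurvatureEquation (η : ℝ) (f : ℤ → ℂ) (ξ δ : ℝ) : Prop :=
  ∀ k, curvature f (k - 1) + curvature f (k + 1) =
    (ξ * curvature f k + δ) / (1 + η ^ 2 / 4 * curvature f k ^ 2)

def IsConstrainedElastic (η : ℝ) (f : ℤ → ℂ) : Prop :=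
  ∃ ξ δ : ℝ, CurvatureEquation η f ξ δ

/-- Discrete circles: curves of constant non-vanishing curvature. -/
def IsDiscreteCircle (f : ℤ → ℂ) : Prop :=
  ∃ κ : ℝ, κ ≠ 0 ∧ ∀ k, curvature f k = κ

/-- Elastic curves. A discrete circle solves the curvature equation for several `(ξ, δ)`; by
convention it counts as area-constrained elastic and not as elastic. -/
def IsElastic (η : ℝ) (f : ℤ → ℂ) : Prop :=
  (∃ ξ : ℝ, CurvatureEquation η f ξ 0) ∧ ¬ IsDiscreteCircle f

def IsAreaConstrainedElastic (η : ℝ) (f : ℤ → ℂ) : Prop :=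
  ∃ ξ δ : ℝ, δ ≠ 0 ∧ CurvatureEquation η f ξ δ

/-! ### The directrix, in the light cone model of Lie circle geometry -/

/-- The inner product of signature `(3, 2)` on `ℝ⁵`. -/
def lieInner (v w : Fin 5 → ℝ) : ℝ :=
  v 0 * w 0 + v 1 * w 1 + v 2 * w 2 - v 3 * w 3 - v 4 * w 4

/-- The light-like vector of a point of the plane. -/
def pointVec (z : ℂ) : Fin 5 → ℝ :=
  ![z.re, z.im, (1 - ‖z‖ ^ 2) / 2, (1 + ‖z‖ ^ 2) / 2, 0]

/-- The light-like vector of the oriented line from `a` to `b`. -/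
def lineVec (a b : ℂ) : Fin 5 → ℝ :=
  let N := edgeNormal a b
  let d := inner ℝ N a
  ![N.re, N.im, -d, d, 1]

/-- The double-curvature circle at `f k`: it touches the oriented lines through the two edges at
`f k` in the points `f (k - 1)` and `f (k + 1)`. -/
def doubleCurvatureCircle (f : ℤ → ℂ) (k : ℤ) : Fin 5 → ℝ :=
  (curvature f k / 2) • pointVec (f (k - 1)) + lineVec (f (k - 1)) (f k)

/-- The linear circle complexes (vectors up to scaling) whose directrix is the circle with centre
`X` and squared radius `ρ` (any real number): adding a multiple of `(0, 0, 0, 0, 1)` makes the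
vector light-like, and then it represents this circle. -/
def complexVec (X : ℂ) (ρ h : ℝ) : Fin 5 → ℝ :=
  ![X.re, X.im, (1 - ‖X‖ ^ 2 + ρ) / 2, (1 + ‖X‖ ^ 2 - ρ) / 2, h]

/-- The circle with centre `X` and squared radius `ρ` is a directrix of `f`: all double-curvature
circles of `f` lie in one linear circle complex with this directrix. -/
def IsDirectrixCircle (f : ℤ → ℂ) (X : ℂ) (ρ : ℝ) : Prop :=
  ∃ h : ℝ, ∀ k, lieInner (doubleCurvatureCircle f k) (complexVec X ρ h) = 0

/-! ### Bäcklund transformations and invariant curves -/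

/-- Euclidean Darboux butterflies `(a, b, c, d)`: the diagonals do not vanish and the reflection in
some line interchanges `a ↔ c` and `b ↔ d`. -/
def IsDarbouxButterfly (a b c d : ℂ) : Prop :=
  a ≠ c ∧ b ≠ d ∧
    ∃ (ℓ : AffineSubspace ℝ ℂ) (_ : Nonempty ℓ), Module.finrank ℝ ℓ.direction = 1 ∧
      EuclideanGeometry.reflection ℓ a = c ∧ EuclideanGeometry.reflection ℓ b = d

def IsBacklundTransform (f g : ℤ → ℂ) : Prop :=
  ∀ k, IsDarbouxButterfly (f k) (f (k + 1)) (g (k + 1)) (g k)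

/-- The plane as the span of the quaternions `i` and `j`. -/
def toQuat (z : ℂ) : ℍ[ℝ] := ⟨0, z.re, z.im, 0⟩

/-- The product `(1 + λ v⁽ⁿ⁻¹⁾) ⋯ (1 + λ v⁽⁰⁾)` at the vertex `k`, where
`v⁽ⁱ⁾ = g (i + 1) k - g i k`, as a polynomial in the central variable `λ`. -/
def transportPoly (g : ℕ → ℤ → ℂ) (k : ℤ) : ℕ → ℍ[ℝ][X]
  | 0 => 1
  | n + 1 => (1 + Polynomial.X * Polynomial.C (toQuat (g (n + 1) k - g n k))) * transportPoly g k n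

/-- The quaternion `E` describes the linear part of the isometry `ψ` by `u ↦ E⁻¹ u E`.
Such an `E` is unique up to a real factor. -/
def Represents (E : ℍ[ℝ]) (ψ : ℂ ≃ᵃⁱ[ℝ] ℂ) : Prop :=
  E ≠ 0 ∧ ∀ u : ℂ, toQuat (ψ.linearIsometryEquiv u) = E⁻¹ * toQuat u * E

/-- `g 0, …, g n` is a regular sequence of Bäcklund transformations of regular arc-length curves
from `f` to `ψ ∘ f`. Regular means that the polynomial
`E (1 + λ v⁽ⁿ⁻¹⁾) ⋯ (1 + λ v⁽⁰⁾)` is not scalar, i.e. has a coefficient with non-zero imaginary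
part. -/
def IsRegularSequence (n : ℕ) (f : ℤ → ℂ) (g : ℕ → ℤ → ℂ) (ψ : ℂ ≃ᵃⁱ[ℝ] ℂ) : Prop :=
  (∀ i ≤ n, ∃ η, IsArcLengthCurve η (g i)) ∧ g 0 = f ∧ (∀ k, g n k = ψ (f k)) ∧
    (∀ i < n, IsBacklundTransform (g i) (g (i + 1))) ∧
    ∃ E, Represents E ψ ∧ ∃ k j, ((Polynomial.C E * transportPoly g k n).coeff j).im ≠ 0

def OrientationPreserving (ψ : ℂ ≃ᵃⁱ[ℝ] ℂ) : Prop :=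
  0 < LinearMap.det (ψ.linearIsometryEquiv.toLinearEquiv : ℂ →ₗ[ℝ] ℂ)

def OrientationReversing (ψ : ℂ ≃ᵃⁱ[ℝ] ℂ) : Prop :=
  LinearMap.det (ψ.linearIsometryEquiv.toLinearEquiv : ℂ →ₗ[ℝ] ℂ) < 0

/-- `f` is `n`-invariant with isometry `ψ`. -/
def IsInvariantWith (n : ℕ) (f : ℤ → ℂ) (ψ : ℂ ≃ᵃⁱ[ℝ] ℂ) : Prop :=
  (Odd n → OrientationPreserving ψ) ∧ (Even n → OrientationReversing ψ) ∧
    ∃ g, IsRegularSequence n f g ψ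

def IsInvariant (n : ℕ) (f : ℤ → ℂ) : Prop := ∃ ψ, IsInvariantWith n f ψ

/-- Translations, including the identity. -/
def IsTranslation (ψ : ℂ ≃ᵃⁱ[ℝ] ℂ) : Prop := ∃ w : ℂ, ∀ z, ψ z = z + w

/-- Rotations by an angle that is not a multiple of `2π`. -/
def IsRotation (ψ : ℂ ≃ᵃⁱ[ℝ] ℂ) : Prop := OrientationPreserving ψ ∧ ¬ IsTranslation ψ

end DiscreteElastica

end

open scoped Quaternion Polynomial

noncomputable section

namespace DiscreteElastica

-- A Darboux butterfly is a refactorization `(1 + λ v') (1 + λ u) = (1 + λ ũ) (1 + λ v)` over the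
-- quaternions. Chaining three of them and closing up with `ψ` gives, for `P = E (1 + λ v₂) (1 + λ
-- v₁) (1 + λ v₀)`, the Lax equation `P (k + 1) (1 + λ u) = (1 + λ u) P k`, where `u = f (k + 1) - f
-- k`. Here `P = E + λ w + λ² p + λ³ s` with `E`, `p` in the span of `1` and `k`, and `w`, `s` in
-- the plane.
--
-- Forward: the Lax equation makes `w` affine and `Im p` quadratic in the position, and its
-- behaviour where `1 + λ u` is singular makes `Im p`, up to a constant, a constant multiple `-M /
-- (2 η)` of the curvature (`IsLaxSolution.exists_curvature_eq`). If `M ≠ 0`, then `κ = A |f|² +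
-- linear` with `A` proportional to `Im E`. If `M = 0`, the curve lies on a circle (`Im E ≠ 0`) or
-- on a line (`Im E = 0`, by regularity). Such a potential is equivalent to the curvature equation
-- with `δ = 2 η² A`, and `ψ` is a translation exactly when `Im E = 0`. For rotations, completing
-- the square shows that the squared tangential distance is proportional to `κ`.
--
-- Backward: a potential gives an explicit Lax solution, to which any real polynomial `e₀ + e₂ λ²`
-- may be added. Its norm, a polynomial in `x = λ²`, does not depend on `k`; for suitable `e₀`, `e₂`
-- it has two distinct negative roots. Each root splits off a linear factor, a third factor remains
-- (`exists_isFactorization`), and the Lax equation turns the three factors into Bäcklund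
-- transformations (`IsLaxSolution.backlund_equations`).

local notation "conj" => starRingEnd ℂ

/-! ### Butterflies as an equation between complex numbers -/

theorem reflection_eq_mul_conj {e : ℂ} (he : e ≠ 0) (v : ℂ) :
    (Submodule.span ℝ {e}).reflection v = e / conj e * conj v := by
  have hc : conj e ≠ 0 := (map_ne_zero _).2 he
  have hn : (‖e‖ : ℂ) ^ 2 = e * conj e := (Complex.mul_conj' e).symm
  rw [Submodule.reflection_singleton_apply, div_mul_eq_mul_div, eq_div_iff hc]
  have hi : ((inner ℝ e v : ℝ) : ℂ) * 2 = v * conj e + conj v * e := by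
    apply Complex.ext <;> simp [Complex.inner] <;> ring
  have h2 : (2 • (inner ℝ e v / (((‖e‖ : ℝ) : ℝ) ^ 2)) • e : ℂ)
      = (v * conj e + conj v * e) / (e * conj e) * e := by
    rw [← hi, ← hn]
    simp only [nsmul_eq_mul, Complex.real_smul]
    push_cast
    ring
  have h3 := congrArg (fun z => (z - v) * conj e) h2
  refine h3.trans ?_
  field_simp
  ring

theorem exists_reflection_eq (ℓ : AffineSubspace ℝ ℂ) [Nonempty ℓ]
    (h : Module.finrank ℝ ℓ.direction = 1) :
    ∃ e : ℂ, ∀ a b : ℂ,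
      EuclideanGeometry.reflection ℓ b - EuclideanGeometry.reflection ℓ a = e * conj (b - a) := by
  obtain ⟨⟨e, hel⟩, he0, he⟩ := finrank_eq_one_iff'.1 h
  have hspan : ℓ.direction = Submodule.span ℝ {e} := by
    apply le_antisymm
    · intro x hx
      obtain ⟨c, hc⟩ := he ⟨x, hx⟩
      exact Submodule.mem_span_singleton.2 ⟨c, congrArg Subtype.val hc⟩
    · rw [Submodule.span_singleton_le_iff_mem]; exact hel
  have he1 : e ≠ 0 := fun h0 => he0 (Subtype.ext h0)
  refine ⟨e / conj e, fun a b => ?_⟩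
  rw [EuclideanGeometry.reflection_apply, EuclideanGeometry.reflection_apply]
  have key : ∀ v, ℓ.direction.reflection v = e / conj e * conj v := by
    intro v
    rw [← reflection_eq_mul_conj he1]
    simp only [hspan]
  simp only [key, vsub_eq_sub, vadd_eq_add, map_sub]
  ring

/-- A reflection acts on differences by `z ↦ e * conj z`; eliminating `e` between two sides of the
quad leaves this identity, the `λ²` coefficient of the refactorization. -/
theorem IsDarbouxButterfly.mul_conj_eq {a b c d : ℂ} (h : IsDarbouxButterfly a b c d) :
    (c - b) * conj (b - a) = (c - d) * conj (d - a) := by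
  obtain ⟨-, -, ℓ, hℓ, hd, hac, hbd⟩ := h
  obtain ⟨e, he⟩ := exists_reflection_eq ℓ hd
  have h1 := he a b
  have h2 := he a d
  have hdb : EuclideanGeometry.reflection ℓ d = b := by
    rw [← hbd, EuclideanGeometry.reflection_reflection]
  rw [hac, hbd] at h1
  rw [hac, hdb] at h2
  linear_combination (-conj (b - a)) * h2 + conj (d - a) * h1

/-- The axis is the perpendicular bisector of `a` and `c`; the identity and the equal side lengths
then place the image of `b` at `d`. -/
theorem isDarbouxButterfly_of_mul_conj_eq {a b c d : ℂ} (hac : a ≠ c) (hbd : b ≠ d)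
    (hn : ‖b - a‖ = ‖c - d‖) (h : (c - b) * conj (b - a) = (c - d) * conj (d - a)) :
    IsDarbouxButterfly a b c d := by
  refine ⟨hac, hbd, ?_⟩
  have hp : c - a ≠ 0 := sub_ne_zero.2 hac.symm
  have hpc : conj (c - a) ≠ 0 := (map_ne_zero _).2 hp
  have he : Complex.I * (c - a) ≠ 0 := mul_ne_zero Complex.I_ne_zero hp
  set e := Complex.I * (c - a) with he_def
  let ℓ : AffineSubspace ℝ ℂ := AffineSubspace.mk' ((a + c) / 2) (Submodule.span ℝ {e})
  have hmem : (a + c) / 2 ∈ ℓ := AffineSubspace.self_mem_mk' _ _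
  have : Nonempty ℓ := ⟨⟨_, hmem⟩⟩
  have hdir : ℓ.direction = Submodule.span ℝ {e} := AffineSubspace.direction_mk' _ _
  have key : ∀ z, EuclideanGeometry.reflection ℓ z
      = e / conj e * conj (z - (a + c) / 2) + (a + c) / 2 := by
    intro z
    rw [EuclideanGeometry.reflection_apply_of_mem ℓ _ hmem, ← reflection_eq_mul_conj he]
    simp only [hdir, vsub_eq_sub, vadd_eq_add]
  have hee : e / conj e = - ((c - a) / conj (c - a)) := by
    rw [he_def, map_mul, Complex.conj_I]
    have := Complex.I_ne_zero
    field_simp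
  have c2 : conj (2 : ℂ) = 2 := Complex.conj_ofNat 2
  have hn2 : (b - a) * conj (b - a) = (c - d) * conj (c - d) := by
    rw [Complex.mul_conj', Complex.mul_conj', hn]
  refine ⟨ℓ, inferInstance, ?_, ?_, ?_⟩
  · rw [hdir]; exact finrank_span_singleton he
  · rw [key, hee]
    have : conj (a - (a + c) / 2) = - conj (c - a) / 2 := by
      rw [show a - (a + c) / 2 = - (c - a) / 2 by ring, map_div₀, map_neg, c2]
    rw [this]
    field_simp
    ring
  · rw [key, hee, neg_mul, div_mul_eq_mul_div, ← sub_eq_zero]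
    have h2 : conj (b - (a + c) / 2) = conj b - (conj a + conj c) / 2 := by
      rw [map_sub, map_div₀, map_add, c2]
    rw [h2]
    field_simp
    simp only [map_sub] at *
    linear_combination (-2) * hn2 - 2 * h

/-! ### Quaternions as pairs of complex numbers -/

/-- The complex numbers as the span of the quaternions `1` and `k`. -/
def ofComplex (z : ℂ) : ℍ[ℝ] := ⟨z.re, 0, 0, z.im⟩

@[simp] theorem ofComplex_re (z : ℂ) : (ofComplex z).re = z.re := rfl
@[simp] theorem ofComplex_imI (z : ℂ) : (ofComplex z).imI = 0 := rfl
@[simp] theorem ofComplex_imJ (z : ℂ) : (ofComplex z).imJ = 0 := rfl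
@[simp] theorem ofComplex_imK (z : ℂ) : (ofComplex z).imK = z.im := rfl
@[simp] theorem toQuat_re (z : ℂ) : (toQuat z).re = 0 := rfl
@[simp] theorem toQuat_imI (z : ℂ) : (toQuat z).imI = z.re := rfl
@[simp] theorem toQuat_imJ (z : ℂ) : (toQuat z).imJ = z.im := rfl
@[simp] theorem toQuat_imK (z : ℂ) : (toQuat z).imK = 0 := rfl

theorem ofComplex_mul_ofComplex (a b : ℂ) : ofComplex a * ofComplex b = ofComplex (a * b) := by
  ext <;> simp

theorem ofComplex_mul_toQuat (a z : ℂ) : ofComplex a * toQuat z = toQuat (a * z) := by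
  ext <;> simp

theorem toQuat_mul_ofComplex (z a : ℂ) : toQuat z * ofComplex a = toQuat (conj a * z) := by
  ext <;> simp <;> ring

theorem toQuat_mul_toQuat (z w : ℂ) : toQuat z * toQuat w = ofComplex (-(z * conj w)) := by
  ext <;> simp <;> ring

theorem ofComplex_add (a b : ℂ) : ofComplex (a + b) = ofComplex a + ofComplex b := by
  ext <;> simp

theorem toQuat_add (a b : ℂ) : toQuat (a + b) = toQuat a + toQuat b := by
  ext <;> simp

theorem toQuat_injective : Function.Injective toQuat := fun a b h => by
  have h1 := congrArg QuaternionAlgebra.imI h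
  have h2 := congrArg QuaternionAlgebra.imJ h
  exact Complex.ext h1 h2

theorem toQuat_im_ne_zero {z : ℂ} (h : z ≠ 0) : (toQuat z).im ≠ 0 := by
  intro h0
  apply h
  have h1 := congrArg QuaternionAlgebra.imI h0
  have h2 := congrArg QuaternionAlgebra.imJ h0
  exact Complex.ext h1 h2

/-- The product `E (1 + λ v₂) (1 + λ v₁) (1 + λ v₀)` for `v₀, v₁, v₂` in the plane and `E` in the
span of `1` and `k`. -/
theorem C_mul_transportPoly_three (E : ℂ) (g : ℕ → ℤ → ℂ) (k : ℤ) {v₀ v₁ v₂ : ℂ}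
    (h₀ : g 1 k - g 0 k = v₀) (h₁ : g 2 k - g 1 k = v₁) (h₂ : g 3 k - g 2 k = v₂) :
    Polynomial.C (ofComplex E) * transportPoly g k 3 =
      Polynomial.C (ofComplex E) + Polynomial.X * Polynomial.C (toQuat (E * (v₀ + v₁ + v₂))) +
      Polynomial.X ^ 2 *
        Polynomial.C (ofComplex (-(E * (v₂ * conj v₁ + v₂ * conj v₀ + v₁ * conj v₀)))) +
      Polynomial.X ^ 3 * Polynomial.C (toQuat (-(E * v₂ * conj v₁ * v₀))) := by
  have e1 : toQuat (E * (v₀ + v₁ + v₂)) = ofComplex E * (toQuat v₀ + toQuat v₁ + toQuat v₂) := by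
    rw [← toQuat_add, ← toQuat_add, ofComplex_mul_toQuat]
  have e2 : ofComplex (-(E * (v₂ * conj v₁ + v₂ * conj v₀ + v₁ * conj v₀))) =
      ofComplex E * (toQuat v₂ * toQuat v₁ + toQuat v₂ * toQuat v₀ + toQuat v₁ * toQuat v₀) := by
    simp only [toQuat_mul_toQuat, ← ofComplex_add, ofComplex_mul_ofComplex]
    congr 1; ring
  have e3 : toQuat (-(E * v₂ * conj v₁ * v₀)) =
      ofComplex E * (toQuat v₂ * (toQuat v₁ * toQuat v₀)) := by
    rw [toQuat_mul_toQuat, toQuat_mul_ofComplex, ofComplex_mul_toQuat]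
    congr 1; simp; ring
  rw [e1, e2, e3]
  simp only [transportPoly, h₀, h₁, h₂, map_mul, map_add, mul_one, zero_add, Nat.reduceAdd]
  generalize Polynomial.C (ofComplex E) = c
  generalize Polynomial.C (toQuat v₀) = c₀
  generalize Polynomial.C (toQuat v₁) = c₁
  generalize Polynomial.C (toQuat v₂) = c₂
  have x0 : c₀ * Polynomial.X = Polynomial.X * c₀ := (Polynomial.X_mul).symm
  have x1 : c₁ * Polynomial.X = Polynomial.X * c₁ := (Polynomial.X_mul).symm
  have x2 : c₂ * Polynomial.X = Polynomial.X * c₂ := (Polynomial.X_mul).symm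
  have x3 : c * Polynomial.X = Polynomial.X * c := (Polynomial.X_mul).symm
  have y : ∀ (p q : ℍ[ℝ][X]), p * (Polynomial.X * q) = Polynomial.X * (p * q) := fun p q => by
    rw [← mul_assoc, ← Polynomial.X_mul, mul_assoc]
  simp only [mul_add, add_mul, mul_one, one_mul, pow_succ, pow_zero, mul_assoc, y]
  abel

theorem coeff_cubic (E p : ℂ) (w s : ℂ) (j : ℕ) :
    ((Polynomial.C (ofComplex E) + Polynomial.X * Polynomial.C (toQuat w) +
      Polynomial.X ^ 2 * Polynomial.C (ofComplex p) +
      Polynomial.X ^ 3 * Polynomial.C (toQuat s) : ℍ[ℝ][X]).coeff j) =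
      (if j = 0 then ofComplex E else 0) + (if j = 1 then toQuat w else 0) +
      (if j = 2 then ofComplex p else 0) + (if j = 3 then toQuat s else 0) := by
  simp only [Polynomial.X_pow_mul, Polynomial.X_mul, Polynomial.coeff_add, Polynomial.coeff_C]
  rw [← pow_one (Polynomial.X : ℍ[ℝ][X])]
  simp only [← pow_mul, Polynomial.coeff_C_mul_X_pow, one_mul]

theorem coeff_cubic_im_eq_zero {E p w s : ℂ} (hE : E.im = 0) (hw : w = 0) (hp : p.im = 0)
    (hs : s = 0) (j : ℕ) :
    ((Polynomial.C (ofComplex E) + Polynomial.X * Polynomial.C (toQuat w) +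
      Polynomial.X ^ 2 * Polynomial.C (ofComplex p) +
      Polynomial.X ^ 3 * Polynomial.C (toQuat s) : ℍ[ℝ][X]).coeff j).im = 0 := by
  rw [coeff_cubic, hw, hs]
  ext <;> split_ifs <;> simp [hE, hp]

/-- An orientation preserving isometry is described by a quaternion in the span of `1` and `k`. -/
theorem Represents.exists_eq_ofComplex {E : ℍ[ℝ]} {ψ : ℂ ≃ᵃⁱ[ℝ] ℂ} (h : Represents E ψ)
    (hψ : OrientationPreserving ψ) :
    ∃ e : ℂ, e ≠ 0 ∧ E = ofComplex e ∧
      ∀ u : ℂ, e * ψ.linearIsometryEquiv u = conj e * u := by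
  obtain ⟨hE, h⟩ := h
  obtain ⟨a, ha | ha⟩ := linear_isometry_complex ψ.linearIsometryEquiv
  · have hmul : ∀ u : ℂ, E * toQuat (a * u) = toQuat u * E := by
      intro u
      have := h u
      rw [ha, rotation_apply] at this
      rw [this, ← mul_assoc, ← mul_assoc, mul_inv_cancel₀ hE, one_mul]
    have h1 := hmul 1
    have h2 := hmul Complex.I
    simp [Quaternion.ext_iff] at h1 h2
    have hx1 : E.imI = 0 := by linarith [h1.1, h2.2.2.2]
    have hx2 : E.imJ = 0 := by linarith [h2.1, h1.2.2.2]
    have hEe : E = ofComplex ⟨E.re, E.imK⟩ := by ext <;> simp [hx1, hx2]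
    refine ⟨⟨E.re, E.imK⟩, ?_, hEe, ?_⟩
    · intro h0
      apply hE
      rw [hEe, h0]; ext <;> simp
    · intro u
      apply toQuat_injective
      rw [ha, rotation_apply, ← ofComplex_mul_toQuat, ← toQuat_mul_ofComplex, ← hEe, hmul]
  · exfalso
    unfold OrientationPreserving at hψ
    rw [ha] at hψ
    have hd : (LinearMap.det ((Complex.conjLIE.trans (rotation a)).toLinearEquiv : ℂ →ₗ[ℝ] ℂ))
        = -1 := by
      have : ((Complex.conjLIE.trans (rotation a)).toLinearEquiv : ℂ →ₗ[ℝ] ℂ) =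
        ((rotation a).toLinearEquiv : ℂ →ₗ[ℝ] ℂ) ∘ₗ
          (Complex.conjAe.toLinearEquiv : ℂ →ₗ[ℝ] ℂ) := by
        ext
        all_goals simp
      rw [this, LinearMap.det_comp, det_rotation, one_mul]
      exact Complex.det_conjAe
    rw [hd] at hψ
    norm_num at hψ

/-! ### Edges and curvature of arc-length curves -/

theorem int_const_of_pred {α : Type*} {g : ℤ → α} (h : ∀ k, g (k - 1) = g k) (k : ℤ) :
    g k = g 0 := by
  induction k using Int.induction_on with
  | zero => rfl
  | succ i ih => rw [← ih, ← h, add_sub_cancel_right]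
  | pred i ih => rw [h, ih]

theorem IsArcLengthCurve.norm_sub {η : ℝ} {f : ℤ → ℂ} (hf : IsArcLengthCurve η f) (k : ℤ) :
    ‖f (k + 1) - f k‖ = η := by
  rw [← dist_eq_norm, dist_comm]; exact hf.2.1 k

theorem IsArcLengthCurve.norm_sub_pred {η : ℝ} {f : ℤ → ℂ} (hf : IsArcLengthCurve η f) (k : ℤ) :
    ‖f k - f (k - 1)‖ = η := by
  simpa using hf.norm_sub (k - 1)

theorem IsArcLengthCurve.mul_conj_sub {η : ℝ} {f : ℤ → ℂ} (hf : IsArcLengthCurve η f) (k : ℤ) :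
    (f (k + 1) - f k) * conj (f (k + 1) - f k) = (η : ℂ) ^ 2 := by
  rw [Complex.mul_conj', hf.norm_sub]

theorem IsArcLengthCurve.mul_conj_sub_pred {η : ℝ} {f : ℤ → ℂ} (hf : IsArcLengthCurve η f)
    (k : ℤ) : (f k - f (k - 1)) * conj (f k - f (k - 1)) = (η : ℂ) ^ 2 := by
  rw [Complex.mul_conj', hf.norm_sub_pred]

theorem IsArcLengthCurve.sub_ne_zero {η : ℝ} {f : ℤ → ℂ} (hf : IsArcLengthCurve η f) (k : ℤ) :
    f (k + 1) - f k ≠ 0 := by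
  rw [← norm_ne_zero_iff, hf.norm_sub]; exact hf.1.ne'

/-- The difference of consecutive edges is a multiple of the rotated sum. -/
theorem IsArcLengthCurve.sub_eq_curvature_mul {η : ℝ} {f : ℤ → ℂ} (hf : IsArcLengthCurve η f)
    (k : ℤ) : (f (k + 1) - f k) - (f k - f (k - 1)) =
      Complex.I * (η * curvature f k / 2 : ℝ) * (f (k + 1) - f (k - 1)) := by
  have hη : (η : ℂ) ≠ 0 := Complex.ofReal_ne_zero.2 hf.1.ne'
  have h1 := hf.norm_sub_pred k
  have h2 := hf.norm_sub k
  have hab : f (k - 1) ≠ f k := by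
    intro h0; rw [h0, sub_self, norm_zero] at h1; exact hf.1.ne h1
  have := edgeNormal_sub_edgeNormal hab (hf.2.2 k) (h1.trans h2.symm)
  rw [edgeNormal, edgeNormal, h1, h2, ← sub_div, div_eq_iff hη] at this
  change _ = ((curvature f k / 2 : ℝ) : ℂ) * _ * _ at this
  push_cast at this ⊢
  linear_combination Complex.I * this +
    ((f (k + 1) - f k) - (f k - f (k - 1))) * Complex.I_sq

theorem IsArcLengthCurve.curvature_re_im {η : ℝ} {f : ℤ → ℂ} (hf : IsArcLengthCurve η f) (k : ℤ) :
    ((f (k + 1)).re - (f k).re) - ((f k).re - (f (k - 1)).re) =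
        -(η * curvature f k / 2) * ((f (k + 1)).im - (f (k - 1)).im) ∧
      ((f (k + 1)).im - (f k).im) - ((f k).im - (f (k - 1)).im) =
        (η * curvature f k / 2) * ((f (k + 1)).re - (f (k - 1)).re) := by
  have h := hf.sub_eq_curvature_mul k
  have h1 := congrArg Complex.re h
  have h2 := congrArg Complex.im h
  constructor
  · simpa [-Complex.ofReal_div, -Complex.ofReal_mul, Complex.ofReal_re] using h1
  · simpa [-Complex.ofReal_div, -Complex.ofReal_mul, Complex.ofReal_re] using h2

theorem IsArcLengthCurve.re_sq_add_im_sq {η : ℝ} {f : ℤ → ℂ} (hf : IsArcLengthCurve η f) (k : ℤ) :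
    ((f (k + 1)).re - (f k).re) ^ 2 + ((f (k + 1)).im - (f k).im) ^ 2 = η ^ 2 := by
  rw [← hf.norm_sub k, Complex.sq_norm, Complex.normSq_apply]
  simp; ring

theorem IsArcLengthCurve.re_sq_add_im_sq_pred {η : ℝ} {f : ℤ → ℂ} (hf : IsArcLengthCurve η f)
    (k : ℤ) : ((f k).re - (f (k - 1)).re) ^ 2 + ((f k).im - (f (k - 1)).im) ^ 2 = η ^ 2 := by
  simpa using hf.re_sq_add_im_sq (k - 1)

/-! ### Curvature potentials and the curvature equation -/

/-- The curvature of `f` is the restriction of a quadratic function with leading part `A |z|²`. -/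
def IsCurvaturePotential (f : ℤ → ℂ) (A : ℝ) (n : ℂ) (ρ : ℝ) : Prop :=
  ∀ k, curvature f k = A * ‖f k‖ ^ 2 + (conj n * f k).re + ρ

theorem IsCurvaturePotential.re_im {f : ℤ → ℂ} {A : ℝ} {n : ℂ} {ρ : ℝ}
    (h : IsCurvaturePotential f A n ρ) (k : ℤ) :
    curvature f k = A * ((f k).re ^ 2 + (f k).im ^ 2) + (n.re * (f k).re + n.im * (f k).im) + ρ := by
  rw [h k, Complex.sq_norm, Complex.normSq_apply]
  simp only [Complex.mul_re, Complex.conj_re, Complex.conj_im]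
  ring

/-- The gradient of the potential is `G = n + 2 A f`. By the turning relation, the change of the
edge paired with `G` is `-η κ / 2` times the derivative of the potential along `f (k + 1) - f (k -
1)`. Since both edges have length `η`, that derivative is the curvature difference between these two
points. -/
theorem IsCurvaturePotential.exists_first_integral {η : ℝ} {f : ℤ → ℂ}
    (hf : IsArcLengthCurve η f) {A : ℝ} {n : ℂ} {ρ : ℝ} (h : IsCurvaturePotential f A n ρ) :
    ∃ H : ℝ, ∀ k, η * curvature f k * curvature f (k + 1) / 2 +
      (conj (f (k + 1) - f k) * (n + 2 * A * f k)).im = H := by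
  refine ⟨_, int_const_of_pred fun k => ?_⟩
  have e1 := h.re_im (k - 1)
  have e2 := h.re_im k
  have e3 := h.re_im (k + 1)
  obtain ⟨c1, c2⟩ := hf.curvature_re_im k
  have n1 := hf.re_sq_add_im_sq k
  have n2 := hf.re_sq_add_im_sq_pred k
  rw [sub_add_cancel]
  simp only [Complex.mul_im, Complex.conj_re, Complex.conj_im, Complex.add_re, Complex.add_im,
    Complex.sub_re, Complex.sub_im, Complex.mul_re, Complex.ofReal_re, Complex.ofReal_im,
    Complex.re_ofNat, Complex.im_ofNat]
  generalize (f (k + 1)).re = x₂ at *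
  generalize (f (k + 1)).im = y₂ at *
  generalize (f k).re = x₁ at *
  generalize (f k).im = y₁ at *
  generalize (f (k - 1)).re = x₀ at *
  generalize (f (k - 1)).im = y₀ at *
  generalize n.re = p at *
  generalize n.im = q at *
  generalize curvature f (k - 1) = κ₀ at *
  generalize curvature f k = κ₁ at *
  generalize curvature f (k + 1) = κ₂ at *
  linear_combination (-(q + 2 * A * y₁)) * c1 + (p + 2 * A * x₁) * c2 + η * κ₁ / 2 * (e1 - e3)
    - η * κ₁ / 2 * A * (n1 - n2)

/-- The second difference of the potential is `2 η² A` plus the gradient paired with the difference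
of the edges. The turning relation rewrites this pairing through the first integral `H` on both
edges, so `ξ = 2 + η H`. -/
theorem IsCurvaturePotential.curvatureEquation {η : ℝ} {f : ℤ → ℂ}
    (hf : IsArcLengthCurve η f) {A : ℝ} {n : ℂ} {ρ : ℝ} (h : IsCurvaturePotential f A n ρ) :
    ∃ ξ : ℝ, CurvatureEquation η f ξ (2 * η ^ 2 * A) := by
  obtain ⟨H, hH⟩ := h.exists_first_integral hf
  refine ⟨2 + η * H, fun k => ?_⟩
  have e0 : 0 < 1 + η ^ 2 / 4 * curvature f k ^ 2 := by positivity
  rw [eq_div_iff e0.ne']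
  have e1 := h.re_im (k - 1)
  have e2 := h.re_im k
  have e3 := h.re_im (k + 1)
  obtain ⟨c1, c2⟩ := hf.curvature_re_im k
  have n1 := hf.re_sq_add_im_sq k
  have n2 := hf.re_sq_add_im_sq_pred k
  have g1 := hH k
  have g2 := hH (k - 1)
  rw [sub_add_cancel] at g2
  simp only [Complex.mul_im, Complex.conj_re, Complex.conj_im, Complex.add_re, Complex.add_im,
    Complex.sub_re, Complex.sub_im, Complex.mul_re, Complex.ofReal_re, Complex.ofReal_im,
    Complex.re_ofNat, Complex.im_ofNat] at g1 g2
  generalize (f (k + 1)).re = x₂ at *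
  generalize (f (k + 1)).im = y₂ at *
  generalize (f k).re = x₁ at *
  generalize (f k).im = y₁ at *
  generalize (f (k - 1)).re = x₀ at *
  generalize (f (k - 1)).im = y₀ at *
  generalize n.re = p at *
  generalize n.im = q at *
  generalize curvature f (k - 1) = κ₀ at *
  generalize curvature f k = κ₁ at *
  generalize curvature f (k + 1) = κ₂ at *
  linear_combination e1 - 2 * e2 + e3 + A * (n1 + n2) + (p + 2 * A * x₁) * c1
    + (q + 2 * A * y₁) * c2 + η * κ₁ / 2 * (g1 + g2)

theorem CurvatureEquation.exists_potential {η : ℝ} {f : ℤ → ℂ} (hf : IsArcLengthCurve η f)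
    {ξ A : ℝ} (h : CurvatureEquation η f ξ (2 * η ^ 2 * A)) :
    ∃ (n : ℂ) (ρ : ℝ), IsCurvaturePotential f A n ρ := by
  have hη : (η : ℂ) ≠ 0 := Complex.ofReal_ne_zero.2 hf.1.ne'
  set H : ℝ := (ξ - 2) / η with hH
  have hξ : ξ = 2 + η * H := by rw [hH, mul_div_cancel₀ _ hf.1.ne']; ring
  -- The gradient the potential must have at `f k`, rebuilt from its component along the edge (the
  -- curvature difference) and across it (the first integral). The curvature equation says that `ν k
  -- - 2 A f k` is independent of `k`; this constant is `n`.
  set ν : ℤ → ℂ := fun k => (f (k + 1) - f k) / η ^ 2 *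
    ((curvature f (k + 1) - curvature f k - A * η ^ 2 : ℝ) +
      Complex.I * (H - η * curvature f k * curvature f (k + 1) / 2 : ℝ)) with hν
  have hconst : ∀ k, ν (k - 1) - 2 * A * f (k - 1) = ν k - 2 * A * f k := by
    intro k
    have hk := h k
    have e0 : 0 < 1 + η ^ 2 / 4 * curvature f k ^ 2 := by have := hf.1; positivity
    rw [eq_div_iff e0.ne', hξ] at hk
    have hk' := congrArg (fun x : ℝ => (x : ℂ)) hk
    have c := hf.sub_eq_curvature_mul k
    have hne : 1 - Complex.I * (η * curvature f k / 2 : ℝ) ≠ 0 := by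
      intro h0
      have := congrArg Complex.re h0
      simp [-Complex.ofReal_div, -Complex.ofReal_mul] at this
    have hu : (f (k + 1) - f k) * (1 - Complex.I * (η * curvature f k / 2 : ℝ)) =
        (f k - f (k - 1)) * (1 + Complex.I * (η * curvature f k / 2 : ℝ)) := by
      linear_combination c
    have hfk : f (k - 1) = f k - (f k - f (k - 1)) := by ring
    simp only [hν, sub_add_cancel]
    generalize f (k + 1) - f k = u at *
    rw [show 2 * (A : ℂ) * f (k - 1) = 2 * A * f k - 2 * A * (f k - f (k - 1)) by ring]
    generalize f k - f (k - 1) = e at *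
    generalize curvature f (k - 1) = κ₀ at *
    generalize curvature f k = κ₁ at *
    generalize curvature f (k + 1) = κ₂ at *
    apply mul_right_cancel₀ hne
    -- With the edge directions removed by `hu`, this scalar identity is the curvature equation.
    have hb : (1 - Complex.I * (η * κ₁ / 2 : ℝ)) *
        (((κ₁ - κ₀ - A * η ^ 2 : ℝ) + Complex.I * (H - η * κ₀ * κ₁ / 2 : ℝ)) + 2 * A * η ^ 2) =
        (1 + Complex.I * (η * κ₁ / 2 : ℝ)) *
          ((κ₂ - κ₁ - A * η ^ 2 : ℝ) + Complex.I * (H - η * κ₁ * κ₂ / 2 : ℝ)) := by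
      push_cast at hk' ⊢
      linear_combination (-hk') - η * κ₁ / 2 *
        (2 * H - η * κ₀ * κ₁ / 2 - η * κ₁ * κ₂ / 2) * Complex.I_sq
    generalize ((κ₁ - κ₀ - A * η ^ 2 : ℝ) + Complex.I * (H - η * κ₀ * κ₁ / 2 : ℝ)) = α at *
    generalize ((κ₂ - κ₁ - A * η ^ 2 : ℝ) + Complex.I * (H - η * κ₁ * κ₂ / 2 : ℝ)) = β at *
    clear hne
    generalize ((η * κ₁ / 2 : ℝ) : ℂ) = τ at *
    field_simp
    linear_combination (-β) * hu + e * hb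
  have hc := int_const_of_pred (g := fun k => ν k - 2 * A * f k) hconst
  have hstep : ∀ k, curvature f (k + 1) - curvature f k =
      A * (‖f (k + 1)‖ ^ 2 - ‖f k‖ ^ 2) +
        (conj (ν 0 - 2 * A * f 0) * (f (k + 1) - f k)).re := by
    intro k
    rw [← show _ = ν 0 - 2 * A * f 0 from hc k]
    have h1 : ν k * conj (f (k + 1) - f k) =
        ((curvature f (k + 1) - curvature f k - A * η ^ 2 : ℝ) +
          Complex.I * (H - η * curvature f k * curvature f (k + 1) / 2 : ℝ)) := by
      have := hf.mul_conj_sub k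
      simp only [hν]
      rw [div_mul_eq_mul_div, div_mul_eq_mul_div, div_eq_iff (pow_ne_zero 2 hη), ← this]
      ring
    have h2 := congrArg Complex.re h1
    have n1 := hf.re_sq_add_im_sq k
    rw [Complex.sq_norm, Complex.sq_norm, Complex.normSq_apply, Complex.normSq_apply]
    simp only [Complex.mul_im, Complex.conj_re, Complex.conj_im, Complex.add_re, Complex.sub_re,
      Complex.sub_im, Complex.mul_re, Complex.ofReal_re, Complex.ofReal_im,
      Complex.re_ofNat, Complex.im_ofNat, Complex.I_re, Complex.I_im] at h2 ⊢
    linear_combination (-h2) - A * n1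
  set n := ν 0 - 2 * A * f 0
  refine ⟨n, curvature f 0 - A * ‖f 0‖ ^ 2 - (conj n * f 0).re, fun k => ?_⟩
  have := int_const_of_pred
    (g := fun k => curvature f k - A * ‖f k‖ ^ 2 - (conj n * f k).re) (fun k => by
      have := hstep (k - 1)
      rw [sub_add_cancel, mul_sub (conj n), Complex.sub_re] at this
      linear_combination -this) k
  linear_combination this

/-! ### Tangential distance and the directrix -/

theorem isCurvaturePotential_of_norm_sub_sq {f : ℤ → ℂ} {X : ℂ} {ρ c : ℝ}
    (h : ∀ k, ‖f k - X‖ ^ 2 - ρ = c * curvature f k) (hc : c ≠ 0) :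
    IsCurvaturePotential f c⁻¹ (-(2 * c⁻¹ : ℝ) * X) (c⁻¹ * (‖X‖ ^ 2 - ρ)) := by
  intro k
  have hk : curvature f k = c⁻¹ * (‖f k - X‖ ^ 2 - ρ) := by
    rw [h k, inv_mul_cancel_left₀ hc]
  rw [hk]
  simp only [Complex.sq_norm, Complex.normSq_apply, Complex.mul_re, Complex.sub_re,
    Complex.sub_im, Complex.conj_re, Complex.conj_im, Complex.neg_re, Complex.neg_im,
    Complex.mul_im, Complex.ofReal_re, Complex.ofReal_im]
  ring

theorem isDirectrixCircle_of_norm_sub_sq {η : ℝ} {f : ℤ → ℂ} (hf : IsArcLengthCurve η f)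
    {X : ℂ} {ρ c : ℝ} (h : ∀ k, ‖f k - X‖ ^ 2 - ρ = c * curvature f k) (hc : c ≠ 0) :
    IsDirectrixCircle f X ρ := by
  have hp := isCurvaturePotential_of_norm_sub_sq h hc
  obtain ⟨H, hH⟩ := hp.exists_first_integral hf
  -- Pairing the double-curvature circle with the complex gives `-c κ κ' / 4`, minus the moment of
  -- the edge about `X`, minus `h`. The first integral makes the first two terms constant and fixes
  -- `h`.
  refine ⟨-(c * H / (2 * η)), fun k => ?_⟩
  have hη := hf.1.ne'
  have h1 := hH (k - 1)
  have h2 := h (k - 1)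
  have h3 := hf.norm_sub_pred k
  rw [sub_add_cancel] at h1
  simp only [lieInner, doubleCurvatureCircle, complexVec, pointVec, lineVec, edgeNormal, h3]
  simp only [Pi.add_apply, Pi.smul_apply, smul_eq_mul, Matrix.cons_val, Complex.inner]
  rw [Complex.div_ofReal_re, Complex.div_ofReal_im, map_div₀, Complex.conj_ofReal,
    ← mul_div_assoc (f (k - 1)), Complex.div_ofReal_re]
  simp only [Complex.sq_norm, Complex.normSq_apply, Complex.mul_re, Complex.sub_re, Complex.add_re,
      Complex.sub_im, Complex.conj_re, Complex.conj_im, Complex.neg_re, Complex.neg_im,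
      Complex.mul_im, Complex.ofReal_re, Complex.ofReal_im, Complex.add_im,
      Complex.re_ofNat, Complex.im_ofNat, Complex.I_re, Complex.I_im] at h1 h2 ⊢
  have hcd : c * c⁻¹ = 1 := mul_inv_cancel₀ hc
  have hi : η * η⁻¹ = 1 := mul_inv_cancel₀ hη
  generalize c⁻¹ = d at *
  simp only [div_eq_mul_inv, mul_inv] at h1 ⊢
  generalize η⁻¹ = i at *
  linear_combination (-(curvature f k / 4)) * h2 - c * i / 2 * h1 +
    c * curvature f k * curvature f (k - 1) / 4 * hi + i * (((f k).re - (f (k - 1)).re) *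
      ((f (k - 1)).im - X.im) - ((f k).im - (f (k - 1)).im) * ((f (k - 1)).re - X.re)) * hcd

/-! ### The Lax equation -/

/-- The equation `P (k + 1) (1 + λ u) = (1 + λ u) P k` with `u = f (k + 1) - f k`, written out for
the coefficients of `P = E + λ w + λ² p + λ³ s`, where the even coefficients lie in the span of
`1` and `k` and the odd coefficients in the plane. -/
structure IsLaxSolution (f : ℤ → ℂ) (E : ℂ) (w p s : ℤ → ℂ) : Prop where
  coeff_one : ∀ k, w (k + 1) + E * (f (k + 1) - f k) = conj E * (f (k + 1) - f k) + w k
  coeff_two : ∀ k, p (k + 1) - w (k + 1) * conj (f (k + 1) - f k) =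
    p k - (f (k + 1) - f k) * conj (w k)
  coeff_three : ∀ k, s (k + 1) + p (k + 1) * (f (k + 1) - f k) =
    conj (p k) * (f (k + 1) - f k) + s k
  coeff_four : ∀ k, s (k + 1) * conj (f (k + 1) - f k) = (f (k + 1) - f k) * conj (s k)

/-- The transport polynomials of three Bäcklund transformations solve the Lax equation. -/
theorem IsInvariantWith.exists_isLaxSolution {f : ℤ → ℂ} {ψ : ℂ ≃ᵃⁱ[ℝ] ℂ}
    (h : IsInvariantWith 3 f ψ) :
    ∃ (E : ℂ) (w p s : ℤ → ℂ), E ≠ 0 ∧ (∀ u : ℂ, E * ψ.linearIsometryEquiv u = conj E * u) ∧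
      (∀ k, w k = E * (ψ (f k) - f k)) ∧ IsLaxSolution f E w p s ∧
      ∃ k, E.im ≠ 0 ∨ w k ≠ 0 ∨ (p k).im ≠ 0 ∨ s k ≠ 0 := by
  obtain ⟨hodd, -, g, -, h0, h3, hB, E', hE', k₀, j, hj⟩ := h
  obtain ⟨E, hE0, rfl, hE⟩ := hE'.exists_eq_ofComplex (hodd (by decide))
  have hb0 := fun k => (hB 0 (by norm_num) k).mul_conj_eq
  have hb1 := fun k => (hB 1 (by norm_num) k).mul_conj_eq
  have hb2 := fun k => (hB 2 (by norm_num) k).mul_conj_eq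
  simp only [Nat.reduceAdd, zero_add] at hb0 hb1 hb2
  have hu : ∀ k, E * (g 3 (k + 1) - g 3 k) = conj E * (g 0 (k + 1) - g 0 k) := by
    intro k
    rw [h3, h3, h0, ← hE, ← vsub_eq_sub (f (k + 1)), ← vsub_eq_sub (ψ _)]
    congr 1
    exact (AffineIsometryEquiv.map_vsub ψ _ _).symm
  refine ⟨E, fun k => E * ((g 1 k - g 0 k) + (g 2 k - g 1 k) + (g 3 k - g 2 k)),
    fun k => -(E * ((g 3 k - g 2 k) * conj (g 2 k - g 1 k) +
      (g 3 k - g 2 k) * conj (g 1 k - g 0 k) + (g 2 k - g 1 k) * conj (g 1 k - g 0 k))),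
    fun k => -(E * (g 3 k - g 2 k) * conj (g 2 k - g 1 k) * (g 1 k - g 0 k)), hE0, hE, ?_, ?_, k₀,
    ?_⟩
  · intro k
    simp only [h3, h0]
    ring
  · rw [← h0]
    have key : ∀ k, _ := fun k => And.intro (hb0 k) <| And.intro (hb1 k) <| And.intro (hb2 k) <|
      And.intro (congrArg conj (hb0 k)) <| And.intro (congrArg conj (hb1 k)) <| (hu k)
    simp only [map_mul, map_sub, Complex.conj_conj] at key
    constructor
    · intro k
      linear_combination hu k
    · intro k
      obtain ⟨b0, b1, b2, -, -, e⟩ := key k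
      simp only [map_add, map_mul, map_sub]
      linear_combination (-E) * (b0 + b1 + b2) - (conj (g 3 k) - conj (g 0 k)) * e
    · intro k
      obtain ⟨b0, b1, b2, c0, c1, e⟩ := key k
      simp only [map_add, map_mul, map_sub, map_neg, Complex.conj_conj]
      linear_combination (-E) * ((g 3 (k + 1) - g 1 (k + 1)) * c0 +
        (g 3 (k + 1) - g 2 (k + 1)) * c1 + (g 1 k - g 0 k) * b1 + (g 2 k - g 0 k) * b2) -
        ((conj (g 3 k) - conj (g 2 k)) * (g 2 k - g 0 k) +
          (conj (g 2 k) - conj (g 1 k)) * (g 1 k - g 0 k)) * e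
    · intro k
      obtain ⟨b0, b1, b2, c0, c1, e⟩ := key k
      simp only [map_mul, map_sub, map_neg, Complex.conj_conj]
      linear_combination (-E) * ((g 3 (k + 1) - g 2 (k + 1)) *
          (conj (g 2 (k + 1)) - conj (g 1 (k + 1))) * b0 +
        (g 3 (k + 1) - g 2 (k + 1)) * (conj (g 1 k) - conj (g 0 k)) * c1 +
        (g 2 k - g 1 k) * (conj (g 1 k) - conj (g 0 k)) * b2) -
        ((conj (g 3 k) - conj (g 2 k)) * (g 2 k - g 1 k) * (conj (g 1 k) - conj (g 0 k))) * e
  · by_contra hcon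
    push Not at hcon
    obtain ⟨c1, c2, c3, c4⟩ := hcon
    apply hj
    rw [C_mul_transportPoly_three E g k₀ rfl rfl rfl]
    exact coeff_cubic_im_eq_zero c1 c2 c3 c4 j

/-! ### What a Lax solution forces on the curve -/

variable {η : ℝ} {f : ℤ → ℂ} {E : ℂ} {w p s : ℤ → ℂ}

/-- Up to a factor, `s - η² w` and `Im p - η² Im E` are the values of `w + x s` and `Im (E + x p)`
at `x = -1 / η²`, the zero of the norm `1 + x η²` of the edge factor. The relations come from
splitting the Lax equation into components along and across the edge. -/
theorem IsLaxSolution.edge_relations (hf : IsArcLengthCurve η f) (h : IsLaxSolution f E w p s)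
    (k : ℤ) :
    ((s k - η ^ 2 * w k) * conj (f (k + 1) - f k)).im = η ^ 2 * ((p k).im - E.im * η ^ 2) ∧
    ((s (k + 1) - η ^ 2 * w (k + 1)) * conj (f (k + 1) - f k)).im =
      -(η ^ 2 * ((p (k + 1)).im - E.im * η ^ 2)) ∧
    ((s (k + 1) - η ^ 2 * w (k + 1)) * conj (f (k + 1) - f k)).re =
      ((s k - η ^ 2 * w k) * conj (f (k + 1) - f k)).re ∧
    (p (k + 1)).im - (p k).im =
      ((w (k + 1) + w k) * conj (f (k + 1) - f k)).im := by
  have h1 := h.coeff_one k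
  have h2 := h.coeff_two k
  have h3 := h.coeff_three k
  have h4 := h.coeff_four k
  have hn : (f (k + 1) - f k).re ^ 2 + (f (k + 1) - f k).im ^ 2 = η ^ 2 := by
    rw [← hf.norm_sub k, Complex.sq_norm, Complex.normSq_apply]; ring
  generalize f (k + 1) - f k = u at *
  rw [← Complex.ofReal_pow]
  simp only [Complex.ext_iff, Complex.mul_re, Complex.mul_im, Complex.sub_re, Complex.sub_im,
    Complex.add_re, Complex.add_im, Complex.conj_re, Complex.conj_im, Complex.ofReal_re,
    Complex.ofReal_im] at *
  obtain ⟨a1, a2⟩ := h1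
  obtain ⟨b1, b2⟩ := h2
  obtain ⟨c1, c2⟩ := h3
  obtain ⟨d1, d2⟩ := h4
  generalize u.re = a at *
  generalize u.im = b at *
  generalize (w k).re = w1 at *
  generalize (w k).im = w2 at *
  generalize (w (k + 1)).re = x1 at *
  generalize (w (k + 1)).im = x2 at *
  generalize (s k).re = s1 at *
  generalize (s k).im = s2 at *
  generalize (s (k + 1)).re = r1 at *
  generalize (s (k + 1)).im = r2 at *
  generalize (p k).re = p1 at *
  generalize (p k).im = t at *
  generalize (p (k + 1)).re = q1 at *
  generalize (p (k + 1)).im = t' at *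
  generalize E.im = ε at *
  generalize E.re = e at *
  -- The real part of `p` is conserved.
  have hq : q1 = p1 := by linear_combination b1 + a * a1 + b * a2
  have ht : t' - t = (x2 + w2) * a - (x1 + w1) * b := by linear_combination b2
  have hs : 2 * (s2 * a - s1 * b) = (t + t') * η ^ 2 := by
    rw [hq] at c1 c2
    linear_combination b * c1 - a * c2 + d2 + (t + t') * hn
  have hw : x2 * a - x1 * b = w2 * a - w1 * b - 2 * ε * η ^ 2 := by
    linear_combination a * a2 - b * a1 - 2 * ε * hn
  have hw2 : x1 * a + x2 * b = w1 * a + w2 * b := by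
    linear_combination a * a1 + b * a2
  refine ⟨?_, ?_, ?_, by linear_combination ht⟩
  · linear_combination hs / 2 + η ^ 2 / 2 * ht + η ^ 2 / 2 * hw
  · linear_combination d2 - hs / 2 + η ^ 2 / 2 * ht - η ^ 2 / 2 * hw
  · linear_combination d1 - η ^ 2 * hw2

/-- At `f k` the vector `m = s - η² w` has opposite components across the two equally long edges, so
it is parallel to `f (k + 1) - f (k - 1)`. Hence its components along the edges agree, giving the
constant `M`, and the ratio across to along is `-η κ / 2`, the half-angle tangent. -/
theorem IsLaxSolution.exists_curvature_eq (hf : IsArcLengthCurve η f)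
    (h : IsLaxSolution f E w p s) :
    ∃ M : ℝ, ∀ k, 2 * η * ((p k).im - E.im * η ^ 2) = -(M * curvature f k) ∧
      ((s k - η ^ 2 * w k) * conj (f (k + 1) - f k)).re = M := by
  have hv : ∀ k, 2 * η * ((p k).im - E.im * η ^ 2) =
        -(((s k - η ^ 2 * w k) * conj (f (k + 1) - f k)).re * curvature f k) ∧
      ((s (k - 1) - η ^ 2 * w (k - 1)) * conj (f (k - 1 + 1) - f (k - 1))).re =
        ((s k - η ^ 2 * w k) * conj (f (k + 1) - f k)).re := by
    intro k
    obtain ⟨f1, -, -, -⟩ := h.edge_relations hf k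
    obtain ⟨-, f2, f3, -⟩ := h.edge_relations hf (k - 1)
    obtain ⟨c1, c2⟩ := hf.curvature_re_im k
    have hη := hf.1.ne'
    rw [← f3]
    rw [sub_add_cancel] at *
    generalize s k - η ^ 2 * w k = m at *
    simp only [Complex.mul_re, Complex.mul_im, Complex.sub_re, Complex.sub_im, Complex.conj_re,
      Complex.conj_im] at *
    generalize (f (k + 1)).re = x₂ at *
    generalize (f (k + 1)).im = y₂ at *
    generalize (f k).re = x₁ at *
    generalize (f k).im = y₁ at *
    generalize (f (k - 1)).re = x₀ at *
    generalize (f (k - 1)).im = y₀ at *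
    have e1 : m.re * (x₁ - x₀) + m.im * (y₁ - y₀) = m.re * (x₂ - x₁) + m.im * (y₂ - y₁) := by
      linear_combination (-m.re) * c1 - m.im * c2 - η * curvature f k / 2 * (f1 + f2)
    constructor
    · apply mul_left_cancel₀ hη
      linear_combination f2 - f1 - m.re * c2 + m.im * c1 - η * curvature f k / 2 * e1
    · linear_combination e1
  have hc := int_const_of_pred
    (g := fun k => ((s k - η ^ 2 * w k) * conj (f (k + 1) - f k)).re) fun k => (hv k).2
  exact ⟨_, fun k => ⟨by rw [(hv k).1, hc k], hc k⟩⟩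

theorem IsLaxSolution.coeff_one_eq (h : IsLaxSolution f E w p s) (k : ℤ) :
    w k = (w 0 + 2 * Complex.I * E.im * f 0) - 2 * Complex.I * E.im * f k := by
  have := int_const_of_pred (g := fun k => w k + 2 * Complex.I * E.im * f k) (fun k => by
    have h1 := h.coeff_one (k - 1)
    rw [sub_add_cancel] at h1
    have h2 := Complex.sub_conj E
    push_cast at h2
    linear_combination (-h1) + (f k - f (k - 1)) * h2) k
  linear_combination this

theorem IsLaxSolution.exists_im_eq (h : IsLaxSolution f E w p s) (hf : IsArcLengthCurve η f) :
    ∃ C : ℝ, ∀ k, (p k).im = -2 * E.im * ‖f k‖ ^ 2 +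
      2 * (conj (f k) * (w 0 + 2 * Complex.I * E.im * f 0)).im + C := by
  have hw := h.coeff_one_eq
  set W := w 0 + 2 * Complex.I * E.im * f 0
  have := int_const_of_pred (g := fun k => (p k).im - (-2 * E.im * ‖f k‖ ^ 2 +
      2 * (conj (f k) * W).im)) (fun k => by
    obtain ⟨-, -, -, h1⟩ := h.edge_relations hf (k - 1)
    rw [sub_add_cancel, hw k, hw (k - 1)] at h1
    simp only [Complex.sq_norm, Complex.normSq_apply, Complex.mul_im, Complex.mul_re,
      Complex.sub_re, Complex.sub_im, Complex.add_re, Complex.add_im, Complex.conj_re,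
      Complex.conj_im, Complex.ofReal_re, Complex.ofReal_im, Complex.I_re, Complex.I_im,
      Complex.re_ofNat, Complex.im_ofNat] at h1 ⊢
    linear_combination (-h1))
  exact ⟨(p 0).im - (-2 * E.im * ‖f 0‖ ^ 2 + 2 * (conj (f 0) * W).im),
    fun k => by linear_combination this k⟩

/-- The non-degenerate case: the curvature is a quadratic function of the position. -/
theorem IsLaxSolution.exists_isCurvaturePotential (h : IsLaxSolution f E w p s)
    (hf : IsArcLengthCurve η f) {M : ℝ} (hM : M ≠ 0)
    (hp : ∀ k, 2 * η * ((p k).im - E.im * η ^ 2) = -(M * curvature f k)) :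
    ∃ ρ, IsCurvaturePotential f (4 * η * E.im / M)
      ((4 * η / M : ℝ) * Complex.I * (w 0 + 2 * Complex.I * E.im * f 0)) ρ := by
  obtain ⟨C, hC⟩ := h.exists_im_eq hf
  refine ⟨-(2 * η / M) * (C - E.im * η ^ 2), fun k => ?_⟩
  have h1 := hp k
  rw [hC k] at h1
  generalize w 0 + 2 * Complex.I * E.im * f 0 = W at *
  rw [Complex.sq_norm, Complex.normSq_apply] at *
  simp only [Complex.mul_im, Complex.mul_re, map_mul, Complex.conj_ofReal, Complex.conj_I,
    Complex.neg_re, Complex.neg_im, Complex.conj_re,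
    Complex.conj_im, Complex.ofReal_re, Complex.ofReal_im, Complex.I_re, Complex.I_im] at h1 ⊢
  field_simp
  linear_combination h1

theorem norm_sub_sq_of_isCurvaturePotential {A ρ : ℝ} {X : ℂ} (hA : A ≠ 0)
    (h : IsCurvaturePotential f A (-(2 * A : ℝ) * X) ρ) :
    ∃ r : ℝ, ∀ k, ‖f k - X‖ ^ 2 - r = A⁻¹ * curvature f k := by
  refine ⟨‖X‖ ^ 2 - A⁻¹ * ρ, fun k => ?_⟩
  rw [h k]
  simp only [Complex.sq_norm, Complex.normSq_apply, Complex.mul_re, Complex.sub_re,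
    Complex.sub_im, Complex.conj_re, Complex.conj_im, Complex.neg_re, Complex.neg_im,
    Complex.mul_im, Complex.ofReal_re, Complex.ofReal_im]
  field_simp
  ring

/-- Arc-length curves on a circle have constant non-vanishing curvature. -/
theorem IsArcLengthCurve.isDiscreteCircle_of_norm_sub_eq (hf : IsArcLengthCurve η f) {X : ℂ}
    {R : ℝ} (h : ∀ k, ‖f k - X‖ ^ 2 = R) : IsDiscreteCircle f := by
  have hη := hf.1.ne'
  -- The moment of the edges about `X` is constant, and its product with the curvature is `-η`, so
  -- neither vanishes.
  have hk : ∀ k, (conj (f (k - 1 + 1) - f (k - 1)) * (f (k - 1) - X)).im =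
      (conj (f (k + 1) - f k) * (f k - X)).im ∧
      curvature f k * (conj (f (k + 1) - f k) * (f k - X)).im = -η := by
    intro k
    obtain ⟨c1, c2⟩ := hf.curvature_re_im k
    have n1 := hf.re_sq_add_im_sq k
    have n2 := hf.re_sq_add_im_sq_pred k
    have h0 := h (k - 1)
    have h1 := h k
    have h2 := h (k + 1)
    rw [sub_add_cancel]
    simp only [Complex.sq_norm, Complex.normSq_apply, Complex.mul_im, Complex.sub_re,
      Complex.sub_im, Complex.conj_re, Complex.conj_im] at *
    generalize (f (k + 1)).re = x₂ at *
    generalize (f (k + 1)).im = y₂ at *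
    generalize (f k).re = x₁ at *
    generalize (f k).im = y₁ at *
    generalize (f (k - 1)).re = x₀ at *
    generalize (f (k - 1)).im = y₀ at *
    generalize X.re = a at *
    generalize X.im = b at *
    have e : (x₁ - x₀) * (y₀ - b) + -(y₁ - y₀) * (x₀ - a) =
        (x₂ - x₁) * (y₁ - b) + -(y₂ - y₁) * (x₁ - a) := by
      linear_combination (-(y₁ - b)) * c1 + (x₁ - a) * c2 + η * curvature f k / 4 *
        (h2 - h0 - n1 + n2)
    refine ⟨e, ?_⟩
    apply mul_left_cancel₀ hη
    linear_combination (-(x₁ - a)) * c1 - (y₁ - b) * c2 + (h2 - 2 * h1 + h0 - n1 - n2) / 2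
      - η * curvature f k / 2 * e
  have hc := int_const_of_pred
    (g := fun k => (conj (f (k + 1) - f k) * (f k - X)).im) fun k => (hk k).1
  set g := (conj (f (0 + 1) - f 0) * (f 0 - X)).im
  have hg : ∀ k, curvature f k * g = -η := fun k => by rw [← (hk k).2, ← hc k]
  have hg0 : g ≠ 0 := by
    intro h0
    have := hg 0
    rw [h0, mul_zero] at this
    exact hη (by linarith)
  exact ⟨-η / g, div_ne_zero (neg_ne_zero.2 hη) hg0, fun k => by rw [eq_div_iff hg0, hg]⟩

/-- This is the case `M = 0`: both components of `s - η² w` relative to an edge vanish. -/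
theorem IsLaxSolution.degenerate (h : IsLaxSolution f E w p s)
    (hf : IsArcLengthCurve η f) (hp : ∀ k, 2 * η * ((p k).im - E.im * η ^ 2) = 0 ∧
      ((s k - η ^ 2 * w k) * conj (f (k + 1) - f k)).re = 0) (k : ℤ) :
    (p k).im = E.im * η ^ 2 ∧ s k = η ^ 2 * w k ∧
      ((w (k + 1) + w k) * conj (f (k + 1) - f k)).im = 0 := by
  have hη := hf.1.ne'
  have ht : ∀ k, (p k).im = E.im * η ^ 2 := fun k => by
    have := (hp k).1
    simpa [hη, sub_eq_zero] using this
  obtain ⟨h1, -, -, h2⟩ := h.edge_relations hf k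
  refine ⟨ht k, ?_, by rw [← h2, ht, ht, sub_self]⟩
  rw [ht, sub_self, mul_zero] at h1
  have : (s k - η ^ 2 * w k) * conj (f (k + 1) - f k) = 0 := Complex.ext (hp k).2 h1
  rcases mul_eq_zero.1 this with h3 | h3
  · exact sub_eq_zero.1 h3
  · exact absurd ((map_eq_zero _).1 h3) (hf.sub_ne_zero k)

theorem IsLaxSolution.exists_norm_sub_sq (h : IsLaxSolution f E w p s)
    (hf : IsArcLengthCurve η f) (hE : E.im ≠ 0) {X : ℂ}
    (hX : w 0 + 2 * Complex.I * E.im * f 0 = 2 * Complex.I * E.im * X) :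
    ∃ ρ c : ℝ, c ≠ 0 ∧ ∀ k, ‖f k - X‖ ^ 2 - ρ = c * curvature f k := by
  have hη := hf.1.ne'
  obtain ⟨M, hM⟩ := h.exists_curvature_eq hf
  by_cases hM0 : M = 0
  · subst hM0
    simp only [zero_mul, neg_zero] at hM
    have hd := h.degenerate hf hM
    obtain ⟨C, hC⟩ := h.exists_im_eq hf
    have hR : ∀ k, ‖f k - X‖ ^ 2 = (C - E.im * η ^ 2) / (2 * E.im) + ‖X‖ ^ 2 := by
      intro k
      have h1 := hC k
      rw [(hd k).1, hX] at h1
      simp only [Complex.sq_norm, Complex.normSq_apply, Complex.mul_re, Complex.sub_re,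
        Complex.sub_im, Complex.conj_re, Complex.conj_im, Complex.I_re, Complex.I_im,
        Complex.mul_im, Complex.ofReal_re, Complex.ofReal_im, Complex.re_ofNat,
        Complex.im_ofNat] at h1 ⊢
      field_simp
      linear_combination h1
    obtain ⟨κ, -, hκ⟩ := hf.isDiscreteCircle_of_norm_sub_eq hR
    -- Distance and curvature are both constant here, so any `c ≠ 0` works with `ρ` adjusted; `c =
    -- 1` is chosen.
    exact ⟨(C - E.im * η ^ 2) / (2 * E.im) + ‖X‖ ^ 2 - κ, 1, one_ne_zero, fun k => by
      rw [hR, hκ]; ring⟩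
  · obtain ⟨ρ, hρ⟩ := h.exists_isCurvaturePotential hf hM0 fun k => (hM k).1
    have hA : 4 * η * E.im / M ≠ 0 := by positivity
    rw [hX] at hρ
    have e : ((4 * η / M : ℝ) * Complex.I * (2 * Complex.I * E.im * X) : ℂ) =
        -(2 * (4 * η * E.im / M) : ℝ) * X := by
      push_cast
      linear_combination (4 * η / M * 2 * E.im * X : ℂ) * Complex.I_sq
    rw [e] at hρ
    obtain ⟨r, hr⟩ := norm_sub_sq_of_isCurvaturePotential hA hρ
    exact ⟨r, _, inv_ne_zero hA, hr⟩

theorem IsLaxSolution.exists_curvatureEquation_zero (h : IsLaxSolution f E w p s)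
    (hf : IsArcLengthCurve η f) (hE : E.im = 0)
    (hns : ∃ k, E.im ≠ 0 ∨ w k ≠ 0 ∨ (p k).im ≠ 0 ∨ s k ≠ 0) :
    ∃ ξ, CurvatureEquation η f ξ 0 := by
  suffices ∃ n ρ, IsCurvaturePotential f 0 n ρ by
    obtain ⟨n, ρ, hp⟩ := this
    simpa using hp.curvatureEquation hf
  have hη := hf.1.ne'
  obtain ⟨M, hM⟩ := h.exists_curvature_eq hf
  by_cases hM0 : M = 0
  · subst hM0
    simp only [zero_mul, neg_zero] at hM
    have hd := h.degenerate hf hM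
    have hw : ∀ k, w k = w 0 := fun k => by
      have := h.coeff_one_eq k
      simpa [hE] using this
    -- Regularity is needed here: otherwise every coefficient would be real. All edges are then
    -- parallel to `w 0`, so the curvature vanishes.
    have hw0 : w 0 ≠ 0 := by
      intro h0
      obtain ⟨k, hk⟩ := hns
      simp [hE, hw, h0, (hd k).1, (hd k).2.1] at hk
    have hpar : ∀ k, (w 0 * conj (f (k + 1) - f k)).im = 0 := by
      intro k
      have := (hd k).2.2
      rw [hw, hw k, ← two_mul, mul_assoc, Complex.mul_im] at this
      simpa using this
    refine ⟨0, 0, fun k => ?_⟩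
    have h1 := hpar k
    have h2 := hpar (k - 1)
    rw [sub_add_cancel] at h2
    have h3 : (conj (f k - f (k - 1)) * (f (k + 1) - f k)).im = 0 := by
      have h4 : Complex.normSq (w 0) ≠ 0 := by simpa using hw0
      apply mul_left_cancel₀ h4
      generalize f k - f (k - 1) = e at *
      generalize f (k + 1) - f k = u at *
      simp only [Complex.mul_im, Complex.conj_re, Complex.conj_im, Complex.normSq_apply] at *
      linear_combination (-(w 0).re * e.re - (w 0).im * e.im) * h1 +
        ((w 0).re * u.re + (w 0).im * u.im) * h2
    rw [curvature, curvatureAt, h3]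
    simp
  · obtain ⟨ρ, hρ⟩ := h.exists_isCurvaturePotential hf hM0 fun k => (hM k).1
    rw [hE, mul_zero, zero_div] at hρ
    exact ⟨_, ρ, hρ⟩

/-! ### Consequences for invariant curves -/

theorem isTranslation_iff_im_eq_zero {ψ : ℂ ≃ᵃⁱ[ℝ] ℂ} (hE0 : E ≠ 0)
    (hE : ∀ u : ℂ, E * ψ.linearIsometryEquiv u = conj E * u) :
    IsTranslation ψ ↔ E.im = 0 := by
  have hv : ∀ z, ψ z = ψ.linearIsometryEquiv z + ψ 0 := fun z => by
    have := ψ.map_vadd 0 z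
    simpa using this
  constructor
  · rintro ⟨b, hb⟩
    have h1 := hv 1
    rw [hb, hb, zero_add, add_left_inj] at h1
    have h2 := hE 1
    rw [← h1, mul_one, mul_one] at h2
    exact Complex.conj_eq_iff_im.1 h2.symm
  · intro h0
    refine ⟨ψ 0, fun z => ?_⟩
    rw [hv z, add_left_inj]
    have := hE z
    rw [Complex.conj_eq_iff_im.2 h0] at this
    exact mul_left_cancel₀ hE0 this

theorem IsInvariantWith.rotation {ψ : ℂ ≃ᵃⁱ[ℝ] ℂ} (hf : IsArcLengthCurve η f)
    (h : IsInvariantWith 3 f ψ) (hψ : IsRotation ψ) :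
    ∃ (X : ℂ) (ρ c : ℝ), ψ X = X ∧ c ≠ 0 ∧ ∀ k, ‖f k - X‖ ^ 2 - ρ = c * curvature f k := by
  obtain ⟨E, w, p, s, hE0, hE, hw, hL, -⟩ := h.exists_isLaxSolution
  have hε : E.im ≠ 0 := fun h0 => hψ.2 ((isTranslation_iff_im_eq_zero hE0 hE).2 h0)
  have h2 : (2 * Complex.I * E.im : ℂ) ≠ 0 := by simp [hε]
  -- `w = E (ψ f - f)` is affine in the position; `X` is the zero of its affine extension to the
  -- plane, hence the fixed point of `ψ`.
  set X := f 0 + w 0 / (2 * Complex.I * E.im) with hX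
  have hX' : w 0 + 2 * Complex.I * E.im * f 0 = 2 * Complex.I * E.im * X := by
    rw [hX, mul_add, mul_div_cancel₀ _ h2, add_comm]
  obtain ⟨ρ, c, hc, hρ⟩ := hL.exists_norm_sub_sq hf hε hX'
  refine ⟨X, ρ, c, ?_, hc, hρ⟩
  apply mul_left_cancel₀ hE0
  have e1 : ψ X = ψ.linearIsometryEquiv (X - f 0) + ψ (f 0) := by
    have := ψ.map_vadd (f 0) (X - f 0)
    simpa using this
  have e2 := Complex.sub_conj E
  push_cast at e2
  rw [e1, mul_add, hE]
  linear_combination (-hw 0) + hX' - (X - f 0) * e2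

theorem IsInvariantWith.translation {ψ : ℂ ≃ᵃⁱ[ℝ] ℂ} (hf : IsArcLengthCurve η f)
    (h : IsInvariantWith 3 f ψ) (hψ : IsTranslation ψ) :
    ∃ ξ, CurvatureEquation η f ξ 0 := by
  obtain ⟨E, w, p, s, hE0, hE, hw, hL, hns⟩ := h.exists_isLaxSolution
  exact hL.exists_curvatureEquation_zero hf
    ((isTranslation_iff_im_eq_zero hE0 hE).1 hψ) hns

/-! ### Bäcklund transforms from the butterfly equation -/

/-- Rewritten as `ũ * conj (v - u) = (v - u) * conj u`, the equation preserves edge lengths as soon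
as `v ≠ u`. The condition `‖v‖ ≠ η` ensures this, and also excludes vanishing diagonals and
backtracking. -/
theorem backlund_of_mul_conj_eq (hf : IsArcLengthCurve η f) {v : ℤ → ℂ} (hv : ∀ k, ‖v k‖ ≠ η)
    (h : ∀ k, v (k + 1) * conj (f (k + 1) - f k) =
      ((f (k + 1) - f k) + v (k + 1) - v k) * conj (v k)) :
    IsArcLengthCurve η (fun k => f k + v k) ∧ IsBacklundTransform f (fun k => f k + v k) := by
  have h1 : ∀ k, ((f (k + 1) - f k) + v (k + 1) - v k) * conj (v k - (f (k + 1) - f k)) =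
      (v k - (f (k + 1) - f k)) * conj (f (k + 1) - f k) := by
    intro k
    have := h k
    rw [map_sub conj (v k)]
    linear_combination (-this)
  have hne : ∀ k, v k - (f (k + 1) - f k) ≠ 0 := by
    intro k h0
    apply hv k
    rw [sub_eq_zero.1 h0, hf.norm_sub]
  have hn : ∀ k, ‖(f (k + 1) - f k) + v (k + 1) - v k‖ = η := by
    intro k
    have := congrArg norm (h1 k)
    rw [norm_mul, norm_mul, Complex.norm_conj, Complex.norm_conj, hf.norm_sub, mul_comm] at this
    exact mul_left_cancel₀ (norm_ne_zero_iff.2 (hne k)) this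
  have hg : ∀ k, f (k + 1) + v (k + 1) - (f k + v k) = (f (k + 1) - f k) + v (k + 1) - v k :=
    fun k => by ring
  refine ⟨⟨hf.1, fun k => ?_, fun k h0 => ?_⟩, fun k => ?_⟩
  · rw [dist_comm, dist_eq_norm, hg, hn]
  · have e1 := h1 k
    have e2 := h (k - 1)
    have n1 := hf.mul_conj_sub k
    have n2 := hf.mul_conj_sub_pred k
    have n3 : ((f k - f (k - 1)) + v k - v (k - 1)) *
        conj ((f k - f (k - 1)) + v k - v (k - 1)) = (η : ℂ) ^ 2 := by
      have := hn (k - 1)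
      rw [sub_add_cancel] at this
      rw [Complex.mul_conj', this]
    rw [sub_add_cancel] at e2
    have hT : conj (f (k + 1) - f (k - 1)) ≠ 0 :=
      (map_ne_zero _).2 (sub_ne_zero.2 (hf.2.2 k).symm)
    have hv2 : v k * conj (v k) - (η : ℂ) ^ 2 ≠ 0 := by
      rw [Complex.mul_conj']
      intro h3
      apply hv k
      have h4 : ‖v k‖ ^ 2 = η ^ 2 := by exact_mod_cast sub_eq_zero.1 h3
      exact (pow_left_inj₀ (norm_nonneg _) hf.1.le two_ne_zero).1 h4
    -- If the new curve backtracks at `k`, its two edges there are opposite; eliminating them from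
    -- the two butterfly equations makes this product zero.
    apply mul_ne_zero hv2 hT
    have h5 : (f (k + 1) - f k) + v (k + 1) - v k = -((f k - f (k - 1)) + v k - v (k - 1)) := by
      linear_combination -h0
    rw [h5] at e1
    have e3 : (v k + (f k - f (k - 1))) * conj (f k - f (k - 1)) =
        ((f k - f (k - 1)) + v k - v (k - 1)) * conj (v k + (f k - f (k - 1))) := by
      simp only [map_sub, map_add] at *
      linear_combination e2 + n2 - n3
    rw [show f (k + 1) - f (k - 1) = (f (k + 1) - f k) + (f k - f (k - 1)) by ring]
    generalize (f k - f (k - 1)) + v k - v (k - 1) = y at *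
    generalize f (k + 1) - f k = u at *
    generalize f k - f (k - 1) = e at *
    simp only [map_sub, map_add] at *
    linear_combination (-(conj (v k) + conj e)) * e1 + (conj (v k) - conj u) * e3 +
      (conj (v k) + conj e) * n1 - (conj (v k) - conj u) * n2
  · apply isDarbouxButterfly_of_mul_conj_eq
    · intro h0
      apply hv (k + 1)
      rw [← hf.norm_sub k, ← norm_neg]
      congr 1
      linear_combination h0
    · intro h0
      apply hne k
      linear_combination -h0
    · rw [hg, hn, hf.norm_sub]
    · rw [hg, add_sub_cancel_left, add_sub_cancel_left]
      exact h k

/-! ### Norm and factorization of Lax solutions -/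

/-- This is the quaternionic norm of `P` with `λ² = x`. Norms multiply, and both sides of the Lax
equation carry the factor `1 + x η²`. It cancels except at `x = -1 / η²`, which continuity covers.
-/
theorem IsLaxSolution.norm_eq (h : IsLaxSolution f E w p s) (hf : IsArcLengthCurve η f) (k : ℤ)
    (x : ℝ) : Complex.normSq (E + x * p k) + x * Complex.normSq (w k + x * s k) =
      Complex.normSq (E + x * p 0) + x * Complex.normSq (w 0 + x * s 0) := by
  refine int_const_of_pred
    (g := fun k => Complex.normSq (E + x * p k) + x * Complex.normSq (w k + x * s k))
    (fun k => ?_) k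
  have key : Set.EqOn (fun x : ℝ => Complex.normSq (E + x * p (k - 1)) +
        x * Complex.normSq (w (k - 1) + x * s (k - 1)))
      (fun x : ℝ => Complex.normSq (E + x * p k) + x * Complex.normSq (w k + x * s k))
      {-(η ^ 2)⁻¹}ᶜ := by
    intro x hx
    have hx' : 1 + x * η ^ 2 ≠ 0 := by
      intro h0
      apply hx
      have := hf.1.ne'
      rw [Set.mem_singleton_iff]
      field_simp
      linarith
    have a1 := h.coeff_one (k - 1)
    have a2 := h.coeff_two (k - 1)
    have a3 := h.coeff_three (k - 1)
    have a4 := h.coeff_four (k - 1)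
    have n := hf.mul_conj_sub_pred k
    rw [sub_add_cancel] at a1 a2 a3 a4
    generalize f k - f (k - 1) = u at *
    have b1 : (E + x * p k) - x * (w k + x * s k) * conj u =
        (E + x * p (k - 1)) - x * u * conj (w (k - 1) + x * s (k - 1)) := by
      rw [map_add, map_mul, Complex.conj_ofReal]
      linear_combination (x : ℂ) * a2 - (x : ℂ) ^ 2 * a4
    have b2 : (w k + x * s k) + (E + x * p k) * u =
        (w (k - 1) + x * s (k - 1)) + conj (E + x * p (k - 1)) * u := by
      rw [map_add, map_mul, Complex.conj_ofReal]
      linear_combination a1 + (x : ℂ) * a3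
    have hu : u.re ^ 2 + u.im ^ 2 = η ^ 2 := by
      have := congrArg Complex.re n
      rw [← Complex.ofReal_pow] at this
      simp only [Complex.mul_re, Complex.conj_re, Complex.conj_im, Complex.ofReal_re] at this
      linarith
    change Complex.normSq (E + x * p (k - 1)) + x * Complex.normSq (w (k - 1) + x * s (k - 1)) =
      Complex.normSq (E + x * p k) + x * Complex.normSq (w k + x * s k)
    generalize E + x * p (k - 1) = A at *
    generalize E + x * p k = A' at *
    generalize w (k - 1) + x * s (k - 1) = B at *
    generalize w k + x * s k = B' at *
    apply mul_left_cancel₀ hx'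
    have c1 := congrArg Complex.normSq b1
    have c2 := congrArg Complex.normSq b2
    simp only [Complex.normSq_apply, Complex.mul_re, Complex.mul_im, Complex.sub_re,
      Complex.sub_im, Complex.add_re, Complex.add_im, Complex.conj_re, Complex.conj_im,
      Complex.ofReal_re, Complex.ofReal_im] at c1 c2 ⊢
    linear_combination (-c1) - x * c2 - x * (A.re ^ 2 + A.im ^ 2 - A'.re ^ 2 - A'.im ^ 2 +
      x * (B.re ^ 2 + B.im ^ 2 - B'.re ^ 2 - B'.im ^ 2)) * hu
  have hc : ∀ k, Continuous (fun x : ℝ => Complex.normSq (E + x * p k) +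
        x * Complex.normSq (w k + x * s k)) := fun k => by
    have := Complex.continuous_normSq
    fun_prop
  exact congrFun (Continuous.ext_on (dense_compl_singleton _) (hc _) (hc _) key) x

/-- The evaluation at a root of the norm determines the Bäcklund transform. -/
theorem mul_conj_sub_eq_of_evaluation {A B A' B' u u₁ v v' : ℂ} {x : ℝ}
    (h₁ : A' - x * B' * conj u₁ = A - x * u * conj B) (h₂ : B' + A' * u₁ = B + conj A * u)
    (hB : A * v = B) (hB' : A' * v' = B') (hx : x * (v * conj v) = -1) (hA' : A' ≠ 0) :
    v' * conj u₁ = (u₁ + v' - v) * conj v := by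
  have hx0 : (x : ℂ) ≠ 0 := by intro h0; simp [h0] at hx
  apply mul_left_cancel₀ hx0
  apply mul_left_cancel₀ hA'
  subst hB hB'
  simp only [map_mul] at h₁
  linear_combination (-h₁) - x * conj v * h₂ + (A' - A) * hx

/-- The factorization `E + λ w + λ² p + λ³ s = E (1 + λ v₂) (1 + λ v₁) (1 + λ v₀)` in which `v₀` and
`v₁` belong to the roots `x` and `y` of the norm as a polynomial in `λ²`. -/
structure IsFactorization (E w p s : ℂ) (x y : ℝ) (v₀ v₁ v₂ : ℂ) : Prop where
  norm_zero : x * (v₀ * conj v₀) = -1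
  eval_zero : (E + x * p) * v₀ = w + x * s
  norm_one : y * (v₁ * conj v₁) = -1
  eval_one : (E + y * (p + (w - E * v₀) * conj v₀)) * v₁ = w - E * v₀
  eval_ne : E + y * (p + (w - E * v₀) * conj v₀) ≠ 0
  coeff_one : E * (v₀ + v₁ + v₂) = w
  coeff_two : p + (w - E * v₀) * conj v₀ = -(E * v₂ * conj v₁)
  coeff_three : (p + (w - E * v₀) * conj v₀) * v₀ = s
  norm_eq : ∀ r : ℝ, Complex.normSq (E + r * p) + r * Complex.normSq (w + r * s) =
    Complex.normSq E * (1 + r * Complex.normSq v₀) * (1 + r * Complex.normSq v₁) *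
      (1 + r * Complex.normSq v₂)

/-- Multiplicativity of the norm for `(a + λ b) (1 + λ v)`, with `λ² = x`. -/
theorem normSq_mul_linear (a b v : ℂ) (x : ℝ) :
    Complex.normSq (a - x * b * conj v) + x * Complex.normSq (b + a * v) =
      (Complex.normSq a + x * Complex.normSq b) * (1 + x * Complex.normSq v) := by
  simp only [Complex.normSq_apply, Complex.mul_re, Complex.mul_im, Complex.sub_re,
      Complex.sub_im, Complex.add_re, Complex.add_im, Complex.conj_re, Complex.conj_im,
      Complex.ofReal_re, Complex.ofReal_im]
  ring

theorem mul_normSq_div_eq {a b : ℂ} {x : ℝ} (ha : a ≠ 0)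
    (h : Complex.normSq a + x * Complex.normSq b = 0) :
    (x : ℂ) * (b / a * conj (b / a)) = -1 := by
  rw [Complex.mul_conj, Complex.normSq_div]
  have : Complex.normSq a ≠ 0 := by simpa using ha
  have h2 : x * (Complex.normSq b / Complex.normSq a) = -1 := by
    field_simp; linarith
  exact_mod_cast h2

/-- At a root `x` of the norm, `v₀ = (w + x s) / (E + x p)` makes `1 + λ v₀` a right factor, with
quotient `E + λ q₁ + λ² q₂`. The norm of the quotient still vanishes at `y`, so a second factor
splits off and a linear one remains. -/
theorem exists_isFactorization {E w p s : ℂ} {x y : ℝ} (hE : E ≠ 0) (hxy : x ≠ y)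
    (hx : E + x * p ≠ 0) (hy : E + y * p ≠ 0)
    (hx0 : Complex.normSq (E + x * p) + x * Complex.normSq (w + x * s) = 0)
    (hy0 : Complex.normSq (E + y * p) + y * Complex.normSq (w + y * s) = 0) :
    ∃ v₀ v₁ v₂, IsFactorization E w p s x y v₀ v₁ v₂ := by
  set v₀ := (w + x * s) / (E + x * p) with hv₀
  have n0 : x * (v₀ * conj v₀) = -1 := mul_normSq_div_eq hx hx0
  have e0 : (E + x * p) * v₀ = w + x * s := mul_div_cancel₀ _ hx
  have hxC : (x : ℂ) ≠ 0 := by intro h0; simp [h0] at n0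
  set q₁ := w - E * v₀ with hq₁
  set q₂ := p + q₁ * conj v₀ with hq₂
  -- The remainder of the division vanishes because `x |v₀|² = -1`.
  have hs : q₂ * v₀ = s := by
    apply mul_left_cancel₀ hxC
    rw [hq₂, hq₁]
    linear_combination e0 + (w - E * v₀) * n0
  have hA : ∀ r : ℝ, E + r * p = (E + r * q₂) - r * q₁ * conj v₀ := fun r => by rw [hq₂]; ring
  have hB : ∀ r : ℝ, w + r * s = q₁ + (E + r * q₂) * v₀ := fun r => by rw [← hs, hq₁]; ring
  have hD : ∀ r : ℝ, Complex.normSq (E + r * p) + r * Complex.normSq (w + r * s) =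
      (Complex.normSq (E + r * q₂) + r * Complex.normSq q₁) * (1 + r * Complex.normSq v₀) :=
    fun r => by rw [hA, hB, normSq_mul_linear]
  have n0' : x * Complex.normSq v₀ = -1 := by
    rw [Complex.mul_conj] at n0; exact_mod_cast n0
  have hy1 : Complex.normSq (E + y * q₂) + y * Complex.normSq q₁ = 0 := by
    have h1 := hD y
    rw [hy0, eq_comm, mul_eq_zero] at h1
    refine h1.resolve_right fun h2 => hxy ?_
    have h3 : Complex.normSq v₀ ≠ 0 := by intro h0; simp [h0] at n0'
    apply mul_right_cancel₀ h3
    linarith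
  have hyq : E + y * q₂ ≠ 0 := by
    intro h0
    rw [h0, Complex.normSq_zero, zero_add, mul_eq_zero] at hy1
    apply hy
    rw [hA, h0]
    rcases hy1 with h1 | h1
    · simp [h1]
    · simp [Complex.normSq_eq_zero.1 h1]
  set v₁ := q₁ / (E + y * q₂) with hv₁
  have n1 : y * (v₁ * conj v₁) = -1 := mul_normSq_div_eq hyq hy1
  have e1 : (E + y * q₂) * v₁ = q₁ := mul_div_cancel₀ _ hyq
  have hyC : (y : ℂ) ≠ 0 := by intro h0; simp [h0] at n1
  have e2 : E * ((q₁ - E * v₁) / E) = q₁ - E * v₁ := mul_div_cancel₀ _ hE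
  have e3 : q₂ = -(E * ((q₁ - E * v₁) / E) * conj v₁) := by
    rw [e2]
    apply mul_left_cancel₀ hyC
    linear_combination (-(y * conj v₁)) * e1 + (E + y * q₂ - E) * n1
  refine ⟨v₀, v₁, (q₁ - E * v₁) / E, n0, e0, n1, e1, hyq, ?_, e3, hs, fun r => ?_⟩
  · linear_combination e2
  · rw [hD]
    have h1 : E + r * q₂ = E - r * (q₁ - E * v₁) * conj v₁ := by rw [e3, e2]; ring
    have h2 := normSq_mul_linear E (q₁ - E * v₁) v₁ r
    rw [sub_add_cancel, ← h1] at h2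
    have h3 : Complex.normSq (q₁ - E * v₁) =
        Complex.normSq E * Complex.normSq ((q₁ - E * v₁) / E) := by
      rw [← Complex.normSq_mul, e2]
    rw [h2, h3]
    ring

/-- Evaluating the Lax equation at `λ² = x` gives the first butterfly. Cancelling its factor leaves
an equation of the same kind for the quadratic quotient, which is evaluated at `y`; the third
butterfly is what then remains. -/
theorem IsLaxSolution.backlund_equations (h : IsLaxSolution f E w p s) (hE : E ≠ 0) {x y : ℝ}
    {v₀ v₁ v₂ : ℤ → ℂ}
    (hv : ∀ k, IsFactorization E (w k) (p k) (s k) x y (v₀ k) (v₁ k) (v₂ k))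
    (hx : ∀ k, E + x * p k ≠ 0) (k : ℤ) {u₀ u₁ u₂ u₃ : ℂ} (hu₀ : u₀ = f (k + 1) - f k)
    (hu₁ : u₁ = u₀ + v₀ (k + 1) - v₀ k) (hu₂ : u₂ = u₁ + v₁ (k + 1) - v₁ k)
    (hu₃ : u₃ = u₂ + v₂ (k + 1) - v₂ k) :
    v₀ (k + 1) * conj u₀ = u₁ * conj (v₀ k) ∧ v₁ (k + 1) * conj u₁ = u₂ * conj (v₁ k) ∧
      v₂ (k + 1) * conj u₂ = u₃ * conj (v₂ k) := by
  have a1 := h.coeff_one k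
  have a2 := h.coeff_two k
  have a3 := h.coeff_three k
  have a4 := h.coeff_four k
  rw [← hu₀] at a1 a2 a3 a4
  have F := hv k
  have F' := hv (k + 1)
  have hx' := hx (k + 1)
  generalize v₀ k = a at *
  generalize v₁ k = b at *
  generalize v₂ k = c at *
  generalize v₀ (k + 1) = a' at *
  generalize v₁ (k + 1) = b' at *
  generalize v₂ (k + 1) = c' at *
  generalize w k = w₀ at *
  generalize p k = p₀ at *
  generalize s k = s₀ at *
  generalize w (k + 1) = w₁ at *
  generalize p (k + 1) = p₁ at *
  generalize s (k + 1) = s₁ at *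
  have ha : conj a ≠ 0 := by intro h0; simpa [h0] using F.norm_zero
  have hb : b ≠ 0 := by intro h0; simpa [h0] using F.norm_one
  have g0 : a' * conj u₀ = u₁ * conj a := by
    rw [hu₁]
    refine mul_conj_sub_eq_of_evaluation (x := x) (u := u₀) ?_ ?_ F.eval_zero F'.eval_zero F.norm_zero hx'
    · rw [map_add, map_mul, Complex.conj_ofReal]
      linear_combination (x : ℂ) * a2 - (x : ℂ) ^ 2 * a4
    · rw [map_add, map_mul, Complex.conj_ofReal]
      linear_combination a1 + (x : ℂ) * a3
  -- `c1`, `c2`, `c3` are the coefficients of the equation for the quotient, with edge `u₁` on the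
  -- left and `u₀` on the right.
  have c1 : (w₁ - E * a') + E * u₁ = (w₀ - E * a) + conj E * u₀ := by
    rw [hu₁]; linear_combination a1
  have c2 : (p₁ + (w₁ - E * a') * conj a') - (w₁ - E * a') * conj u₁ =
      (p₀ + (w₀ - E * a) * conj a) - u₀ * conj (w₀ - E * a) := by
    have e : conj u₁ = conj u₀ + conj a' - conj a := by rw [hu₁, map_sub, map_add]
    rw [e, map_sub, map_mul]
    rw [hu₁] at g0
    linear_combination a2 + conj a * a1 + E * g0
  have c3 : (p₁ + (w₁ - E * a') * conj a') * u₁ =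
      conj (p₀ + (w₀ - E * a) * conj a) * u₀ := by
    apply mul_right_cancel₀ ha
    have e1 := F'.coeff_three
    have e2 := congrArg conj F.coeff_three
    rw [map_mul] at e2
    linear_combination (-(p₁ + (w₁ - E * a') * conj a')) * g0 + conj u₀ * e1 + a4 - u₀ * e2
  have g1 : b' * conj u₁ = u₂ * conj b := by
    rw [hu₂]
    refine mul_conj_sub_eq_of_evaluation (x := y) (u := u₀) ?_ ?_ F.eval_one F'.eval_one
      F.norm_one F'.eval_ne
    · linear_combination (y : ℂ) * c2
    · rw [map_add, map_mul conj (y : ℂ), Complex.conj_ofReal]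
      linear_combination c1 + (y : ℂ) * c3
  refine ⟨g0, g1, ?_⟩
  apply mul_left_cancel₀ (mul_ne_zero hE hb)
  have e1 : E * u₃ = conj E * u₀ := by
    rw [hu₃, hu₂, hu₁]
    linear_combination a1 + F'.coeff_one - F.coeff_one
  have g1' := congrArg conj g1
  rw [F'.coeff_two, F.coeff_two] at c3
  simp only [map_neg, map_mul, Complex.conj_conj] at c3 g1'
  linear_combination (-c3) - E * c' * g1' - b * conj c * e1

/-! ### Choosing the norm to have two roots -/

theorem exists_cubic_neg {a b c d : ℝ} (hd : 0 < d) :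
    ∃ x < 0, a + b * x + c * x ^ 2 + d * x ^ 3 < 0 := by
  set S := |a| + |b| + |c| with hS
  set y := 1 + S / d with hy
  have hS0 : 0 ≤ S := by positivity
  have hy1 : 1 ≤ y := by rw [hy]; have := div_nonneg hS0 hd.le; linarith
  have hdy : d * y = d + S := by rw [hy]; field_simp
  refine ⟨-y, by linarith, ?_⟩
  have h1 : a ≤ |a| * y ^ 2 := 
    (le_abs_self a).trans (le_mul_of_one_le_right (abs_nonneg a) (one_le_pow₀ hy1))
  have h2 : -b * y ≤ |b| * y ^ 2 :=
    (mul_le_mul_of_nonneg_right (neg_le_abs b) (by linarith)).trans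
      (mul_le_mul_of_nonneg_left (le_self_pow₀ hy1 two_ne_zero) (abs_nonneg b))
  have h3 : c * y ^ 2 ≤ |c| * y ^ 2 := mul_le_mul_of_nonneg_right (le_abs_self c) (by positivity)
  have h4 : d * y ^ 3 = (d + S) * y ^ 2 := by rw [← hdy]; ring
  have h5 : 0 < d * y ^ 2 := by positivity
  have h6 : S * y ^ 2 = |a| * y ^ 2 + |b| * y ^ 2 + |c| * y ^ 2 := by rw [hS]; ring
  nlinarith

/-- The norm is `(Im E + x Im p)² + x |w + x s|²`. If `s 0 ≠ 0`, it is a cubic with positive leading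
coefficient. If `s 0 = 0`, then `s 1 = 0` and `Im p` changes sign between the vertices `0` and `1`;
as the norm is the same at both, the square can be killed at some `x < 0` when `Im E` and `Im p` are
non-zero, leaving `x |w|² < 0`. The other cases are immediate. -/
theorem IsLaxSolution.exists_norm_neg (h : IsLaxSolution f E w p s) (hf : IsArcLengthCurve η f)
    (hE : E.re = 0) (hp : ∀ k, (p k).re = 0) (hm : ∀ k, s k - η ^ 2 * w k ≠ 0) :
    ∃ x : ℝ, x < 0 ∧
      Complex.normSq (E + x * p 0) + x * Complex.normSq (w 0 + x * s 0) < 0 := by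
  have hN : ∀ k (x : ℝ), Complex.normSq (E + x * p k) = (E.im + x * (p k).im) ^ 2 := by
    intro k x
    rw [Complex.normSq_apply]
    simp [hE, hp]
    ring
  by_cases hs : s 0 = 0
  · have hs1 : s 1 = 0 := by
      have := h.coeff_four 0
      rw [hs, map_zero, mul_zero, mul_eq_zero] at this
      exact this.resolve_right ((map_ne_zero _).2 (hf.sub_ne_zero 0))
    have ht : (p 1).im = -(p 0).im := by
      have := h.coeff_three 0
      rw [zero_add, hs, hs1, zero_add, add_zero] at this
      have := mul_right_cancel₀ (hf.sub_ne_zero 0) this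
      rw [this, Complex.conj_im]
    have hw : ∀ k, s k = 0 → 0 < Complex.normSq (w k) := by
      intro k hk
      rw [Complex.normSq_pos]
      intro h0
      apply hm k
      rw [hk, h0, mul_zero, sub_zero]
    have hw0 := hw 0 hs
    have hw1 := hw 1 hs1
    by_cases ht0 : (p 0).im = 0
    · refine ⟨-(E.im ^ 2 + 1) / Complex.normSq (w 0), ?_, ?_⟩
      · apply div_neg_of_neg_of_pos _ hw0
        nlinarith [sq_nonneg E.im]
      · rw [hN, hs, mul_zero, add_zero, ht0, mul_zero, add_zero, div_mul_cancel₀ _ hw0.ne']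
        linarith
    rcases lt_trichotomy (E.im * (p 0).im) 0 with hlt | heq | hgt
    · have hx : E.im / (p 0).im < 0 := by
        rw [← mul_div_mul_right _ _ ht0]
        exact div_neg_of_neg_of_pos hlt (mul_self_pos.2 ht0)
      refine ⟨E.im / (p 0).im, hx, ?_⟩
      rw [← h.norm_eq hf 1, hN, hs1, ht, mul_zero, add_zero, mul_neg, div_mul_cancel₀ _ ht0,
        add_neg_cancel]
      have := mul_neg_of_neg_of_pos hx hw1
      linarith
    · have hE0 : E.im = 0 := (mul_eq_zero.1 heq).resolve_right ht0
      have hx : -(Complex.normSq (w 0) / (2 * (p 0).im ^ 2)) < 0 := by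
        rw [neg_lt_zero]; positivity
      refine ⟨_, hx, ?_⟩
      rw [hN, hs, mul_zero, add_zero, hE0, zero_add]
      have h2 : -(Complex.normSq (w 0) / (2 * (p 0).im ^ 2)) * (p 0).im ^ 2 =
        -(Complex.normSq (w 0)) / 2 := by field_simp
      rw [mul_pow, pow_two (-(_ / _)), mul_assoc, h2, ← mul_add]
      apply mul_neg_of_neg_of_pos hx
      linarith
    · have hx : -(E.im / (p 0).im) < 0 := by
        rw [neg_lt_zero, ← mul_div_mul_right _ _ ht0]
        exact div_pos hgt (mul_self_pos.2 ht0)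
      refine ⟨-(E.im / (p 0).im), hx, ?_⟩
      rw [hN, hs, mul_zero, add_zero, neg_mul, div_mul_cancel₀ _ ht0, add_neg_cancel]
      have := mul_neg_of_neg_of_pos hx hw0
      linarith
  · obtain ⟨x, hx, hlt⟩ := exists_cubic_neg (a := E.im ^ 2)
      (b := 2 * E.im * (p 0).im + Complex.normSq (w 0))
      (c := (p 0).im ^ 2 + 2 * ((w 0).re * (s 0).re + (w 0).im * (s 0).im))
      (d := Complex.normSq (s 0)) (Complex.normSq_pos.2 hs)
    refine ⟨x, hx, ?_⟩
    rw [hN]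
    convert hlt using 1
    simp only [Complex.normSq_apply, Complex.mul_re, Complex.mul_im, Complex.add_re,
      Complex.add_im, Complex.ofReal_re, Complex.ofReal_im]
    ring

/-- The added square vanishes at `x₀` and is large at `0` and `2 x₀`, so the sum changes sign on
either side of `x₀`. -/
theorem exists_two_roots {N : ℝ → ℝ} (hN : Continuous N) (h0 : 0 ≤ N 0) {x₀ : ℝ} (hx₀ : x₀ < 0)
    (hneg : N x₀ < 0) (b : ℝ) :
    ∃ e₀ e₂ x y : ℝ, e₀ ≠ 0 ∧ x ≠ y ∧ e₀ + e₂ * x ≠ 0 ∧ e₀ + e₂ * y ≠ 0 ∧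
      (e₀ + e₂ * x) ^ 2 + N x = 0 ∧ (e₀ + e₂ * y) ^ 2 + N y = 0 ∧ (e₀ + e₂ * b) ^ 2 + N b ≠ 0 := by
  -- The last two summands dominate `N` at `2 x₀` and at `b`. For `b = x₀` the quotient is `0` by
  -- convention, and `N x₀ < 0` is used instead.
  set e := 1 + |N (2 * x₀)| + |N b| / (1 - b / x₀) ^ 2 with he
  have he1 : 1 + |N (2 * x₀)| ≤ e := by
    rw [he]; have : 0 ≤ |N b| / (1 - b / x₀) ^ 2 := by positivity
    linarith
  have he2 : 1 + |N b| / (1 - b / x₀) ^ 2 ≤ e := by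
    rw [he]; linarith [abs_nonneg (N (2 * x₀))]
  have he0 : 1 ≤ e := le_trans (by linarith [abs_nonneg (N (2 * x₀))]) he1
  have hee : e ≤ e ^ 2 := by nlinarith
  have hlin : ∀ x, e + -e / x₀ * x = e * (1 - x / x₀) := fun x => by ring
  set D : ℝ → ℝ := fun x => (e * (1 - x / x₀)) ^ 2 + N x with hD
  have hDc : Continuous D := by fun_prop
  have d0 : 0 < D 0 := by
    have : D 0 = e ^ 2 + N 0 := by simp [hD]
    rw [this]; nlinarith
  have d1 : D x₀ < 0 := by
    have : D x₀ = N x₀ := by simp [hD, div_self hx₀.ne]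
    rw [this]; exact hneg
  have d2 : 0 < D (2 * x₀) := by
    have : D (2 * x₀) = e ^ 2 + N (2 * x₀) := by
      simp only [hD]
      rw [mul_div_assoc, div_self hx₀.ne]; ring
    rw [this]; linarith [neg_abs_le (N (2 * x₀))]
  obtain ⟨x, ⟨hx1, hx2⟩, hx⟩ := intermediate_value_Ioo hx₀.le hDc.continuousOn ⟨d1, d0⟩
  obtain ⟨y, ⟨hy1, hy2⟩, hy⟩ := intermediate_value_Ioo' (by linarith : 2 * x₀ ≤ x₀)
    hDc.continuousOn ⟨d1, d2⟩
  have hne : ∀ z, z ≠ x₀ → e * (1 - z / x₀) ≠ 0 := by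
    intro z hz
    refine mul_ne_zero (by linarith) ?_
    rw [sub_ne_zero, ne_comm, Ne, div_eq_one_iff_eq hx₀.ne]
    exact hz
  refine ⟨e, -e / x₀, x, y, by linarith, by linarith, ?_, ?_, ?_, ?_, ?_⟩
  · rw [hlin]; exact hne x hx1.ne'
  · rw [hlin]; exact hne y hy2.ne
  · rw [hlin]; exact hx
  · rw [hlin]; exact hy
  · rw [hlin]
    by_cases hb : b = x₀
    · rw [hb, div_self hx₀.ne, sub_self, mul_zero]
      have := hneg.ne
      simpa using this
    · have hc : 0 < (1 - b / x₀) ^ 2 := by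
        have := hne b hb
        have := right_ne_zero_of_mul this
        positivity
      have h1 : (1 - b / x₀) ^ 2 + |N b| ≤ e * (1 - b / x₀) ^ 2 := by
        have := mul_le_mul_of_nonneg_right he2 hc.le
        rwa [add_mul, one_mul, div_mul_cancel₀ _ hc.ne'] at this
      have h2 : e * (1 - b / x₀) ^ 2 ≤ e ^ 2 * (1 - b / x₀) ^ 2 :=
        mul_le_mul_of_nonneg_right hee hc.le
      rw [mul_pow]
      have := neg_abs_le (N b)
      linarith

/-! ### From curvature potentials to invariance -/

/-- A curvature potential yields a solution of the Lax equation. -/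
theorem IsCurvaturePotential.isLaxSolution (hf : IsArcLengthCurve η f) {A ρ : ℝ} {n : ℂ}
    (h : IsCurvaturePotential f A n ρ) (e₀ e₂ : ℝ) :
    IsLaxSolution f (e₀ - Complex.I * A / 2) (fun k => Complex.I * n / 2 + Complex.I * A * f k)
      (fun k => e₂ + Complex.I * (curvature f k - A * η ^ 2 / 2))
      (fun k => (-2 * (η : ℂ)⁻¹ + Complex.I * curvature f k) * (f (k + 1) - f k) +
        η ^ 2 * (Complex.I * n / 2 + Complex.I * A * f k)) := by
  have hi : (η : ℂ) * (η : ℂ)⁻¹ = 1 := mul_inv_cancel₀ (Complex.ofReal_ne_zero.2 hf.1.ne')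
  have c2 : conj (2 : ℂ) = 2 := Complex.conj_ofNat 2
  have hκ : ∀ k, (curvature f k : ℂ) =
      A * (f k * conj (f k)) + (conj n * f k + n * conj (f k)) / 2 + ρ := by
    intro k
    rw [h k]
    push_cast
    rw [Complex.re_eq_add_conj, Complex.mul_conj', map_mul, Complex.conj_conj]
  -- The turning relation lets the first summand of `s (k + 1)` be written on the preceding edge.
  have hs : ∀ k, (-2 * (η : ℂ)⁻¹ + Complex.I * curvature f (k + 1)) *
      (f (k + 1 + 1) - f (k + 1)) =
        (-2 * (η : ℂ)⁻¹ - Complex.I * curvature f (k + 1)) * (f (k + 1) - f k) := by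
    intro k
    have := hf.sub_eq_curvature_mul (k + 1)
    rw [add_sub_cancel_right] at this
    push_cast at this
    linear_combination (-2 * (η : ℂ)⁻¹) * this - Complex.I * curvature f (k + 1) *
      (f (k + 1 + 1) - f k) * hi
  constructor
  · intro k
    simp only [map_sub, map_mul, map_div₀, Complex.conj_ofReal, Complex.conj_I, c2]
    ring
  · intro k
    simp only [map_sub, map_mul, map_div₀, map_add, Complex.conj_ofReal, Complex.conj_I, c2, hκ]
    ring
  · intro k
    simp only [map_sub, map_mul, map_div₀, map_add, map_pow, Complex.conj_ofReal, Complex.conj_I,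
      c2]
    linear_combination hs k
  · intro k
    have n1 := hf.mul_conj_sub k
    have h1 := hκ k
    have h2 := hκ (k + 1)
    have h3 := hs k
    simp only [map_sub, map_mul, map_div₀, map_add, map_neg, map_inv₀, map_pow,
      Complex.conj_ofReal, Complex.conj_I, c2] at n1 ⊢
    linear_combination (conj (f (k + 1)) - conj (f k)) * h3 -
      Complex.I * (curvature f (k + 1) - curvature f k) * n1
      - Complex.I * η ^ 2 * (h2 - h1)

theorem exists_isometry_of_ne_zero (hE : E ≠ 0) (b : ℂ) :
    ∃ ψ : ℂ ≃ᵃⁱ[ℝ] ℂ, OrientationPreserving ψ ∧ Represents (ofComplex E) ψ ∧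
      (∀ u : ℂ, E * ψ.linearIsometryEquiv u = conj E * u) ∧ ∀ z, E * ψ z = conj E * z + b := by
  let ψ : ℂ ≃ᵃⁱ[ℝ] ℂ := (rotation (Circle.ofConjDivSelf E hE)).toAffineIsometryEquiv.trans
    (AffineIsometryEquiv.constVAdd ℝ ℂ (b / E))
  have hlin : ψ.linearIsometryEquiv = rotation (Circle.ofConjDivSelf E hE) := by
    ext; rfl
  have hmul : ∀ u : ℂ, E * ψ.linearIsometryEquiv u = conj E * u := by
    intro u
    rw [hlin, rotation_apply]
    change E * (conj E / E * u) = conj E * u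
    rw [← mul_assoc, mul_div_cancel₀ _ hE]
  have hE' : ofComplex E ≠ 0 := fun h0 => hE (Complex.ext
    (congrArg QuaternionAlgebra.re h0) (congrArg QuaternionAlgebra.imK h0))
  refine ⟨ψ, ?_, ⟨hE', fun u => ?_⟩, hmul, fun z => ?_⟩
  · unfold OrientationPreserving
    rw [hlin, det_rotation]
    exact one_pos
  · apply mul_left_cancel₀ hE'
    rw [ofComplex_mul_toQuat, hmul, ← mul_assoc, ← mul_assoc, mul_inv_cancel₀ hE', one_mul,
      toQuat_mul_ofComplex]
  · have : ψ z = b / E + ψ.linearIsometryEquiv z := rfl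
    rw [this, mul_add, hmul, mul_div_cancel₀ _ hE, add_comm]

/-- A factor with `‖v‖ = η` would make the norm vanish at `-1 / η²`. -/
theorem IsFactorization.norm_ne {x y : ℝ} {E w p s v₀ v₁ v₂ : ℂ}
    (h : IsFactorization E w p s x y v₀ v₁ v₂) (hη : 0 < η)
    (hne : Complex.normSq (E + (-(η ^ 2)⁻¹ : ℝ) * p) +
      -(η ^ 2)⁻¹ * Complex.normSq (w + (-(η ^ 2)⁻¹ : ℝ) * s) ≠ 0) :
    ‖v₀‖ ≠ η ∧ ‖v₁‖ ≠ η ∧ ‖v₂‖ ≠ η := by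
  rw [h.norm_eq] at hne
  have hz : ∀ v : ℂ, ‖v‖ = η → 1 + -(η ^ 2)⁻¹ * Complex.normSq v = 0 := by
    intro v hv
    rw [← Complex.sq_norm, hv]
    field_simp
    ring
  refine ⟨fun h0 => hne ?_, fun h0 => hne ?_, fun h0 => hne ?_⟩ <;> rw [hz _ h0] <;> ring

/-- A solution of the Lax equation whose norm has two suitable roots comes from a sequence of three
Bäcklund transformations. -/
theorem IsLaxSolution.exists_isInvariantWith (h : IsLaxSolution f E w p s)
    (hf : IsArcLengthCurve η f) (hE : E ≠ 0) {x y : ℝ} (hxy : x ≠ y)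
    (hx : ∀ k, E + x * p k ≠ 0) (hy : ∀ k, E + y * p k ≠ 0)
    (hx0 : Complex.normSq (E + x * p 0) + x * Complex.normSq (w 0 + x * s 0) = 0)
    (hy0 : Complex.normSq (E + y * p 0) + y * Complex.normSq (w 0 + y * s 0) = 0)
    (hη : Complex.normSq (E + (-(η ^ 2)⁻¹ : ℝ) * p 0) +
      -(η ^ 2)⁻¹ * Complex.normSq (w 0 + (-(η ^ 2)⁻¹ : ℝ) * s 0) ≠ 0)
    (hns : w 0 ≠ 0 ∨ s 0 ≠ 0) :
    ∃ ψ : ℂ ≃ᵃⁱ[ℝ] ℂ, IsInvariantWith 3 f ψ ∧ (IsTranslation ψ ↔ E.im = 0) := by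
  -- This translation part gives `E ψ (f k) = E f k + w k`, the end point of the sequence.
  obtain ⟨ψ, hψ, hrep, hlin, happ⟩ :=
    exists_isometry_of_ne_zero hE (w 0 + 2 * Complex.I * E.im * f 0)
  choose v₀ v₁ v₂ hv using fun k => exists_isFactorization hE hxy (hx k) (hy k)
    ((h.norm_eq hf k x).trans hx0) ((h.norm_eq hf k y).trans hy0)
  have hne := fun k => (hv k).norm_ne hf.1 (by rw [h.norm_eq hf k]; exact hη)
  have hb := fun k => h.backlund_equations hE hv hx k rfl rfl rfl rfl
  obtain ⟨hf₁, hb₁⟩ := backlund_of_mul_conj_eq hf (fun k => (hne k).1) fun k => (hb k).1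
  set f₁ := fun k => f k + v₀ k with hf₁'
  obtain ⟨hf₂, hb₂⟩ := backlund_of_mul_conj_eq hf₁ (fun k => (hne k).2.1) fun k => by
    have := (hb k).2.1
    rw [show f₁ (k + 1) - f₁ k = f (k + 1) - f k + v₀ (k + 1) - v₀ k by simp only [f₁]; ring]
    exact this
  set f₂ := fun k => f₁ k + v₁ k with hf₂'
  obtain ⟨hf₃, hb₃⟩ := backlund_of_mul_conj_eq hf₂ (fun k => (hne k).2.2) fun k => by
    have := (hb k).2.2
    rw [show f₂ (k + 1) - f₂ k = f (k + 1) - f k + v₀ (k + 1) - v₀ k + v₁ (k + 1) - v₁ k by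
      simp only [f₂, f₁]; ring]
    exact this
  set f₃ := fun k => f₂ k + v₂ k with hf₃'
  have hend : ∀ k, f₃ k = ψ (f k) := by
    intro k
    apply mul_left_cancel₀ hE
    have h1 := (hv k).coeff_one
    have h2 := h.coeff_one_eq k
    have h3 := Complex.sub_conj E
    push_cast at h3
    rw [happ]
    simp only [f₃, f₂, f₁]
    linear_combination h1 + h2 + f k * h3
  let g : ℕ → ℤ → ℂ := fun i => match i with
    | 0 => f
    | 1 => f₁
    | 2 => f₂
    | _ => f₃
  refine ⟨ψ, ⟨fun _ => hψ, fun h3 => absurd h3 (by decide), g, ?_, rfl, hend, ?_, ofComplex E,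
    hrep, 0, ?_⟩, isTranslation_iff_im_eq_zero hE hlin⟩
  · intro i hi
    interval_cases i
    exacts [⟨η, hf⟩, ⟨η, hf₁⟩, ⟨η, hf₂⟩, ⟨η, hf₃⟩]
  · intro i hi
    interval_cases i
    exacts [hb₁, hb₂, hb₃]
  · have e := C_mul_transportPoly_three E g 0 (v₀ := v₀ 0) (v₁ := v₁ 0) (v₂ := v₂ 0)
      (add_sub_cancel_left _ _) (add_sub_cancel_left _ _) (add_sub_cancel_left _ _)
    have e1 : -(E * v₂ 0 * conj (v₁ 0) * v₀ 0) = s 0 := by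
      rw [← (hv 0).coeff_three, (hv 0).coeff_two]; ring
    rw [(hv 0).coeff_one, e1] at e
    rcases hns with h0 | h0
    · refine ⟨1, ?_⟩
      rw [e, coeff_cubic]
      simpa using toQuat_im_ne_zero h0
    · refine ⟨3, ?_⟩
      rw [e, coeff_cubic]
      simpa using toQuat_im_ne_zero h0

/-- The free parameters add `(e₀ + e₂ x)²` to the norm `N`, and a non-zero `e₀ + e₂ x` keeps `E + x
p` non-zero at every vertex. They leave `Im E = -A / 2` unchanged, so `A` alone decides whether `ψ`
is a translation. -/
theorem IsCurvaturePotential.exists_isInvariantWith (hf : IsArcLengthCurve η f) {A ρ : ℝ} {n : ℂ}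
    (h : IsCurvaturePotential f A n ρ) :
    ∃ ψ : ℂ ≃ᵃⁱ[ℝ] ℂ, IsInvariantWith 3 f ψ ∧ (IsTranslation ψ ↔ A = 0) := by
  have hL := h.isLaxSolution hf
  set w : ℤ → ℂ := fun k => Complex.I * n / 2 + Complex.I * A * f k with hw
  set s : ℤ → ℂ := fun k => (-2 * (η : ℂ)⁻¹ + Complex.I * curvature f k) * (f (k + 1) - f k) +
        η ^ 2 * (Complex.I * n / 2 + Complex.I * A * f k) with hs
  have hm : ∀ k, s k - η ^ 2 * w k ≠ 0 := by
    intro k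
    simp only [hs, hw, add_sub_cancel_right]
    refine mul_ne_zero (fun h0 => ?_) (hf.sub_ne_zero k)
    have := congrArg Complex.re h0
    simp [← Complex.ofReal_inv, hf.1.ne'] at this
  have hre : ∀ (e₀ e₂ : ℝ) (k : ℤ) (x : ℝ), ((e₀ - Complex.I * A / 2 : ℂ) +
      x * (e₂ + Complex.I * (curvature f k - A * η ^ 2 / 2))).re = e₀ + e₂ * x := by
    intro e₀ e₂ k x
    simp [← Complex.ofReal_pow]
    ring
  have him : ∀ (e₀ e₂ : ℝ) (k : ℤ) (x : ℝ), ((e₀ - Complex.I * A / 2 : ℂ) +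
      x * (e₂ + Complex.I * (curvature f k - A * η ^ 2 / 2))).im =
        -A / 2 + x * (curvature f k - A * η ^ 2 / 2) := by
    intro e₀ e₂ k x
    simp [← Complex.ofReal_pow]
    ring
  obtain ⟨x₀, hx₀, hneg⟩ := (hL 0 0).exists_norm_neg hf (by simp)
    (fun k => by simp [← Complex.ofReal_pow]) hm
  set N : ℝ → ℝ := fun x => (-A / 2 + x * (curvature f 0 - A * η ^ 2 / 2)) ^ 2 +
    x * Complex.normSq (w 0 + x * s 0) with hN
  have hD : ∀ e₀ e₂ x : ℝ, Complex.normSq ((e₀ - Complex.I * A / 2 : ℂ) +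
      x * (e₂ + Complex.I * (curvature f 0 - A * η ^ 2 / 2))) +
        x * Complex.normSq (w 0 + x * s 0) = (e₀ + e₂ * x) ^ 2 + N x := by
    intro e₀ e₂ x
    rw [Complex.normSq_apply, hre, him, hN]
    ring
  have hNc : Continuous N := by
    have := Complex.continuous_normSq
    fun_prop
  have hN0 : 0 ≤ N 0 := by
    simp only [hN, zero_mul, add_zero]; positivity
  rw [hD] at hneg
  have hneg' : N x₀ < 0 := by simpa using hneg
  obtain ⟨e₀, e₂, x, y, he₀, hxy, hx, hy, hx0, hy0, hb⟩ :=
    exists_two_roots hNc hN0 hx₀ hneg' (-(η ^ 2)⁻¹)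
  have hne : ∀ (k : ℤ) (x : ℝ), e₀ + e₂ * x ≠ 0 → ((e₀ - Complex.I * A / 2 : ℂ) +
      x * (e₂ + Complex.I * (curvature f k - A * η ^ 2 / 2))) ≠ 0 := by
    intro k x h1 h0
    apply h1
    rw [← hre e₀ e₂ k x, h0, Complex.zero_re]
  obtain ⟨ψ, h1, h2⟩ := (hL e₀ e₂).exists_isInvariantWith hf
    (by simpa using hne 0 0 (by simpa using he₀)) hxy
    (fun k => hne k x hx) (fun k => hne k y hy) ((hD _ _ _).trans hx0) ((hD _ _ _).trans hy0)
    (by rw [hD]; exact hb) (by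
      by_contra hcon
      push Not at hcon
      apply hm 0
      rw [hcon.1, hcon.2, mul_zero, sub_zero])
  refine ⟨ψ, h1, h2.trans ?_⟩
  have := him e₀ e₂ 0 0
  simp only [Complex.ofReal_zero, zero_mul, add_zero] at this
  rw [this]
  constructor
  · intro h3; linarith
  · rintro rfl; simp

theorem CurvatureEquation.exists_isInvariantWith (hf : IsArcLengthCurve η f) {ξ δ : ℝ}
    (h : CurvatureEquation η f ξ δ) :
    ∃ ψ : ℂ ≃ᵃⁱ[ℝ] ℂ, IsInvariantWith 3 f ψ ∧ (IsTranslation ψ ↔ δ = 0) := by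
  have h2 : 2 * η ^ 2 ≠ 0 := by have := hf.1; positivity
  have hδ : δ = 2 * η ^ 2 * (δ / (2 * η ^ 2)) := (mul_div_cancel₀ _ h2).symm
  rw [hδ] at h
  obtain ⟨n, ρ, hp⟩ := h.exists_potential hf
  obtain ⟨ψ, h3, h4⟩ := hp.exists_isInvariantWith hf
  refine ⟨ψ, h3, h4.trans ?_⟩
  rw [div_eq_zero_iff, or_iff_left h2]

theorem IsDiscreteCircle.curvatureEquation (hf : IsDiscreteCircle f) (η : ℝ) :
    ∃ ξ, CurvatureEquation η f ξ 0 := by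
  obtain ⟨κ, -, hκ⟩ := hf
  refine ⟨2 * (1 + η ^ 2 / 4 * κ ^ 2), fun k => ?_⟩
  have : 0 < 1 + η ^ 2 / 4 * κ ^ 2 := by positivity
  simp only [hκ]
  rw [eq_div_iff this.ne']
  ring

end DiscreteElastica

end

open DiscreteElastica in
theorem mainTheorem2 (η : ℝ) (f : ℤ → ℂ) (hf : IsArcLengthCurve η f) :
    (IsInvariant 3 f ↔ IsConstrainedElastic η f) ∧
    (∀ ψ : ℂ ≃ᵃⁱ[ℝ] ℂ, IsInvariantWith 3 f ψ → IsRotation ψ →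
      IsAreaConstrainedElastic η f ∧
      ∃ (X : ℂ) (ρ : ℝ), ψ X = X ∧ IsDirectrixCircle f X ρ ∧
        ∃ c : ℝ, c ≠ 0 ∧ ∀ k, ‖f k - X‖ ^ 2 - ρ = c * curvature f k) ∧
    (∀ ψ : ℂ ≃ᵃⁱ[ℝ] ℂ, IsInvariantWith 3 f ψ → IsTranslation ψ →
      IsElastic η f ∨ IsDiscreteCircle f) ∧
    (IsAreaConstrainedElastic η f → ∃ ψ : ℂ ≃ᵃⁱ[ℝ] ℂ, IsInvariantWith 3 f ψ ∧ IsRotation ψ) ∧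
    (IsElastic η f ∨ IsDiscreteCircle f →
      ∃ ψ : ℂ ≃ᵃⁱ[ℝ] ℂ, IsInvariantWith 3 f ψ ∧ IsTranslation ψ) := by
  have hrot : ∀ ψ : ℂ ≃ᵃⁱ[ℝ] ℂ, IsInvariantWith 3 f ψ → IsRotation ψ →
      IsAreaConstrainedElastic η f ∧
      ∃ (X : ℂ) (ρ : ℝ), ψ X = X ∧ IsDirectrixCircle f X ρ ∧
        ∃ c : ℝ, c ≠ 0 ∧ ∀ k, ‖f k - X‖ ^ 2 - ρ = c * curvature f k := by
    intro ψ h hψ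
    obtain ⟨X, ρ, c, hX, hc, hρ⟩ := h.rotation hf hψ
    obtain ⟨ξ, hξ⟩ := (isCurvaturePotential_of_norm_sub_sq hρ hc).curvatureEquation hf
    refine ⟨⟨ξ, _, ?_, hξ⟩, X, ρ, hX, isDirectrixCircle_of_norm_sub_sq hf hρ hc, c, hc, hρ⟩
    have := hf.1
    positivity
  refine ⟨⟨?_, ?_⟩, hrot, ?_, ?_, ?_⟩
  · rintro ⟨ψ, h⟩
    by_cases hψ : IsTranslation ψ
    · obtain ⟨ξ, hξ⟩ := h.translation hf hψ
      exact ⟨ξ, 0, hξ⟩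
    · obtain ⟨⟨ξ, δ, -, hξ⟩, -⟩ := hrot ψ h ⟨h.1 (by decide), hψ⟩
      exact ⟨ξ, δ, hξ⟩
  · rintro ⟨ξ, δ, h⟩
    obtain ⟨ψ, hψ, -⟩ := h.exists_isInvariantWith hf
    exact ⟨ψ, hψ⟩
  · intro ψ h hψ
    by_cases hc : IsDiscreteCircle f
    · exact Or.inr hc
    · exact Or.inl ⟨h.translation hf hψ, hc⟩
  · rintro ⟨ξ, δ, hδ, h⟩
    obtain ⟨ψ, hψ, ht⟩ := h.exists_isInvariantWith hf
    exact ⟨ψ, hψ, hψ.1 (by decide), fun h0 => hδ (ht.1 h0)⟩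
  · intro h
    have : ∃ ξ, CurvatureEquation η f ξ 0 := h.elim (fun h => h.1) fun h => h.curvatureEquation η
    obtain ⟨ξ, hξ⟩ := this
    obtain ⟨ψ, hψ, ht⟩ := hξ.exists_isInvariantWith hf
    exact ⟨ψ, hψ, ht.2 rfl⟩
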